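/- **Setting.** Let $\mathbb F_q$ be a finite field, $d\ge 5$ odd, $m\mid d$ a positive divisor, $p\in\mathbb F_q[X]$ monic irreducible of degree $d/m$, $\alpha\in\mathbb F_q^\times$, $f=\alpha p^m$, and $h\in\mathbb F_q[X]$ nonzero of degree at most $(d-1)/2$ and not divisible by $p$. Put $\xi=Y^2+h(X)Y-f(X)$, assume that the affine curve $\xi=0$ is smooth, and let $\mathbf A_{\mathcal H}=\mathbb F_q[X][Y]/(\xi)$, with $\overline X,\overline Y$ the classes of $X,Y$. Let $L/\mathbb F_q$ be an extension of degree $d$ with an $\mathbb F_q$-algebra morphism $\gamma:\mathbb F_q[X]\to L$ of kernel $(p)$. Let $L\{\tau\}$ be the ring of Ore polynomials ($\tau a=a^q\tau$ for $a\in L$), and $\tau_L=\tau^d$. An Ore polynomial is separable if its $\tau^0$-coefficient is nonzero. The right-gcd ($\mathrm{rgcd}$) of a set is the monic generator of the left ideal it generates. A Drinfeld $\mathbb F_q[X]$-module over $L$ is an $\mathbb F_q$-algebra morphism $\phi:\mathbb F_q[X]\to L\{\tau\}$, $a\mapsto\phi_a$, such that $\phi_a$ has $\tau^0$-coefficient $\gamma(a)$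 for all $a$ and $\deg_\tau\phi_a>0$ for some $a$. A morphism $\phi\to\psi$ is an $\iota\in L\{\tau\}$ with $\iota\phi_a=\psi_a\iota$ for all $a$; an isogeny is a nonzero morphism. $\mathrm{Dr}_2(\mathbb F_q[X],L)_\xi$ is the set of Drinfeld modules $\phi$ of rank 2 ($\deg_\tau\phi_a=2\deg a$) whose Frobenius $\tau_L$ has characteristic polynomial $\xi$, i.e. $\xi(\phi_X,\tau_L)=0$; these are ordinary because $p\nmid h$. For an isogeny $\iota:\phi\to\psi$ in $\mathrm{Dr}_2(\mathbb F_q[X],L)_\xi$, the ideal of $\mathbf A_{\mathcal H}$ associated to $\iota$ is $\{g\in\mathbf A_{\mathcal H} : g(\phi_X,\tau_L)\in\mathrm{Hom}(\psi,\phi)\,\iota\}$. **Algorithm** $\textsc{IsogenyToIdeal}(\phi,\iota,u)$. 1. If $u=1$, return $\mathbf A_{\mathcal H}$. 2. Choose a monic prime factor $r$ of $u$ and let $\tilde\iota=\mathrm{rgcd}(\iota,\phi_r)$. 3. If $\tilde\iota=1$, return $\textsc{IsogenyToIdeal}(\phi,\iota,u/r^{\mathrm{val}_r(u)})$. 4.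 Else, if $\tilde\iota=\lambda\phi_r$ with $\lambda\in L^\times$, return $\langle r(\overline X)\rangle\cdot\textsc{IsogenyToIdeal}(\phi,\iota\phi_r^{-1},u/r)$. 5. Else, compute $v=\sum_{i<\deg r}v_iX^i\in\mathbb F_q[X]$ by solving the linear system $y-\sum_i v_i\rho_i=0$ in $v_i\in\mathbb F_q$, where $y$ and $\rho_i$ are the remainders of $\tau_L$ and $\phi_{X^i}$ in the right-divisions by $\tilde\iota$. Compute the codomain $\tilde\phi$ of $\tilde\iota$ by the recursion $\mu_i=\tilde\iota_0^{-q^i}\bigl(\sum_{0\le j\le i}\tilde\iota_j\lambda_{i-j}^{q^j}-\sum_{0\le j<i}\mu_j\tilde\iota_{i-j}^{q^j}\bigr)$, $0\le i\le 2$, where $\phi_X=\sum\lambda_i\tau^i$, $\tilde\iota=\sum\tilde\iota_i\tau^i$, $\tilde\phi_X=\sum\mu_i\tau^i$. Return $\langle r(\overline X),\overline Y-v(\overline X)\rangle\cdot\textsc{IsogenyToIdeal}(\tilde\phi,\iota\tilde\iota^{-1},u/r)$. **Proposition.** Let $\phi,\psi\in\mathrm{Dr}_2(\mathbb F_q[X],L)_\xi$,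 let $\iota:\phi\to\psi$ be a separable isogeny, and let $u\in\mathbb F_q[X]$ be monic such that $\iota$ right-divides $\phi_u$. Then, whatever choices are made for the prime factors $r$ and for the solutions of the linear systems, $\textsc{IsogenyToIdeal}(\phi,\iota,u)$ terminates (all its instructions can be carried out, and there are finitely many recursive calls), and the ideal $\mathfrak a\subset\mathbf A_{\mathcal H}$ that it returns is the ideal associated to $\iota$. Moreover $\iota$ is in turn the isogeny of $\mathfrak a$: for some $c\in L^\times$, the Ore polynomial $c\iota$ is the right-gcd of $\{g(\phi_X,\tau_L):g\in\mathfrak a\}$. It is an isogeny from $\phi$ to a Drinfeld module $\mathfrak a\star\phi$, and $c$ is an isomorphism $\psi\to\mathfrak a\star\phi$. -/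

import Mathlib

open Polynomial

noncomputable section

/-! ## Ore polynomials `L{τ}`, where `τ a = a ^ q τ` and `q = #Fq` -/

section OrePolynomials

variable (Fq L : Type*) [Field Fq] [Fintype Fq] [Field L] [Algebra Fq L]

/-- The action of `Multiplicative ℕ` on `L` in which `n` acts as `a ↦ a ^ (q ^ n)`. -/
abbrev frobAction : MulSemiringAction (Multiplicative ℕ) L :=
  MulSemiringAction.compHom L
    (powersHom (L →+* L) (FiniteField.frobeniusAlgHom Fq L : L →+* L))

/-- The ring `L{τ}`: skew polynomials over `L`, twisted by the `q`-Frobenius. (The field `Fq`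
only enters through the ring structure below.) -/
def Ore (_Fq L : Type*) [Field L] : Type _ := SkewPolynomial L

instance Ore.instRing : Ring (Ore Fq L) :=
  letI := frobAction Fq L
  inferInstanceAs (Ring (SkewPolynomial L))

variable {Fq L}

/-- The constant Ore polynomial `a = a τ⁰`. -/
def Ore.C : L →+* Ore Fq L :=
  letI := frobAction Fq L
  (SkewPolynomial.CRingHom : L →+* SkewPolynomial L)

/-- The variable `τ`. -/
def Ore.tau : Ore Fq L :=
  (SkewPolynomial.X : SkewPolynomial L)

/-- The coefficient of `τ ^ n`. -/
def Ore.coeff (P : Ore Fq L) (n : ℕ) : L :=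
  SkewPolynomial.coeff (P : SkewPolynomial L) n

/-- The `τ`-degree (with value `0` at the zero polynomial). -/
def Ore.tdeg (P : Ore Fq L) : ℕ :=
  (SkewPolynomial.support (P : SkewPolynomial L)).sup id

theorem Ore.tau_mul_C (a : L) :
    (Ore.tau : Ore Fq L) * Ore.C a = Ore.C (a ^ Fintype.card Fq) * Ore.tau := by
  let _ := frobAction Fq L
  have key : (SkewPolynomial.X : SkewPolynomial L) * SkewPolynomial.C a =
      SkewPolynomial.C (a ^ Fintype.card Fq) * SkewPolynomial.X := by
    rw [SkewPolynomial.C_mul_X_eq_monomial, ← SkewPolynomial.monomial_zero_left,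
      SkewPolynomial.X_mul_monomial]
    rfl
  exact key

theorem Ore.induction {motive : Ore Fq L → Prop} (h0 : motive 0)
    (hadd : ∀ P Q, motive P → motive Q → motive (P + Q))
    (hmon : ∀ (a : L) (n : ℕ), motive (Ore.C a * Ore.tau ^ n)) (P : Ore Fq L) : motive P := by
  let _ := frobAction Fq L
  refine SkewPolynomial.induction (motive := motive) P h0 ?_
  intro n r q _ _ hq
  refine hadd _ _ ?_ hq
  have h : (SkewPolynomial.monomial n r : SkewPolynomial L) =
      SkewPolynomial.C r * SkewPolynomial.X ^ n :=
    (@SkewPolynomial.C_mul_X_pow_eq_monomial L _ r _ n).symm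
  rw [h]
  exact hmon r n

theorem Ore.tau_pow_mul_C (n : ℕ) (a : L) :
    (Ore.tau : Ore Fq L) ^ n * Ore.C a = Ore.C (a ^ (Fintype.card Fq ^ n)) * Ore.tau ^ n := by
  induction n generalizing a with
  | zero => simp
  | succ n ih =>
    rw [pow_succ, mul_assoc, Ore.tau_mul_C, ← mul_assoc, ih, mul_assoc, ← pow_mul,
      ← pow_succ']

/-- The constants from `Fq` are central in `L{τ}`. -/
theorem Ore.C_algebraMap_commute (c : Fq) (P : Ore Fq L) :
    Commute (Ore.C (algebraMap Fq L c)) P := by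
  induction P using Ore.induction with
  | h0 => exact Commute.zero_right _
  | hadd P Q hP hQ => exact hP.add_right hQ
  | hmon a n =>
    have h1 : Commute (Ore.C (Fq := Fq) (algebraMap Fq L c)) (Ore.C a) := by
      rw [commute_iff_eq, ← map_mul, ← map_mul, mul_comm]
    have h2 : Commute (Ore.C (Fq := Fq) (algebraMap Fq L c)) Ore.tau := by
      rw [commute_iff_eq, Ore.tau_mul_C, ← map_pow, FiniteField.pow_card]
    exact h1.mul_right (h2.pow_right n)

instance Ore.instAlgebra : Algebra Fq (Ore Fq L) :=
  RingHom.toAlgebra' (Ore.C.comp (algebraMap Fq L))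
    (fun c P => Ore.C_algebraMap_commute c P)

variable (Fq L) in
/-- The Frobenius endomorphism `τ_L = τ ^ [L : Fq]`. -/
def Ore.tauL : Ore Fq L := Ore.tau ^ Module.finrank Fq L

theorem Ore.commute_tauL [FiniteDimensional Fq L] (P : Ore Fq L) :
    Commute P (Ore.tauL Fq L) := by
  have : Finite L := Module.finite_of_finite Fq
  have : Fintype L := Fintype.ofFinite L
  induction P using Ore.induction with
  | h0 => exact Commute.zero_left _
  | hadd P Q hP hQ => exact hP.add_left hQ
  | hmon a n =>
    have h1 : Commute (Ore.C (Fq := Fq) a) (Ore.tauL Fq L) := by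
      have h := Ore.tau_pow_mul_C (Fq := Fq) (Module.finrank Fq L) a
      rw [← Module.card_eq_pow_finrank (K := Fq) (V := L), FiniteField.pow_card] at h
      exact h.symm
    have h2 : Commute (Ore.tau : Ore Fq L) (Ore.tauL Fq L) :=
      Commute.pow_right (Commute.refl _) _
    exact h1.mul_left (h2.pow_left n)

/-- The leading coefficient is `1`. -/
def Ore.IsMonic (P : Ore Fq L) : Prop := P.coeff P.tdeg = 1

/-- The coefficient of `τ⁰` is nonzero. -/
def Ore.IsSeparable (P : Ore Fq L) : Prop := P.coeff 0 ≠ 0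

/-- `P` right-divides `Q`. -/
def Ore.RightDvd (P Q : Ore Fq L) : Prop := ∃ W, Q = W * P

/-- `R` is the remainder in the right-division of `P` by `Q`. -/
def Ore.IsRightRem (P Q R : Ore Fq L) : Prop :=
  (∃ W, P = W * Q + R) ∧ (R = 0 ∨ R.tdeg < Q.tdeg)

/-- `g` is the right-greatest common divisor of `S`: the monic generator of the left ideal
generated by `S`. (For a noncommutative ring, `Ideal` means left ideal.) -/
def Ore.IsRgcd (S : Set (Ore Fq L)) (g : Ore Fq L) : Prop :=
  g.IsMonic ∧ (Ideal.span S : Ideal (Ore Fq L)) = Ideal.span {g}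

end OrePolynomials

/-! ## Drinfeld `Fq[X]`-modules over `L` -/

section Drinfeld

variable {Fq L : Type*} [Field Fq] [Fintype Fq] [Field L] [Algebra Fq L]

/-- A Drinfeld `Fq[X]`-module over `L`, where `L` is an `Fq[X]`-algebra via `γ`. -/
structure DrinfeldModule (γ : Fq[X] →ₐ[Fq] L) where
  /-- the morphism `a ↦ φ_a` -/
  toHom : Fq[X] →ₐ[Fq] Ore Fq L
  coeff_zero : ∀ a, (toHom a).coeff 0 = γ a
  exists_tdeg_pos : ∃ a, 0 < (toHom a).tdeg

namespace DrinfeldModule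

variable {γ : Fq[X] →ₐ[Fq] L}

/-- `φ` has rank `r`: `deg_τ φ_a = r deg a` for all `a`. -/
def HasRank (φ : DrinfeldModule γ) (r : ℕ) : Prop :=
  ∀ a : Fq[X], (φ.toHom a).tdeg = r * a.natDegree

/-- `ι` is a morphism `φ → ψ` of Drinfeld modules (over `L`). -/
def IsMorphism (φ ψ : DrinfeldModule γ) (ι : Ore Fq L) : Prop :=
  ∀ a : Fq[X], ι * φ.toHom a = ψ.toHom a * ι

/-- An isogeny is a nonzero morphism. -/
def IsIsogeny (φ ψ : DrinfeldModule γ) (ι : Ore Fq L) : Prop :=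
  ι ≠ 0 ∧ IsMorphism φ ψ ι

/-- `φ'` is the codomain of the separable isogeny `ι` with domain `φ`, as computed from the
coefficients `λ_i` of `φ_X` and `ι_i` of `ι` by the Vélu-type recursion
`μ_i = ι_0 ^ (-q ^ i) (∑_{j ≤ i} ι_j λ_{i-j} ^ (q ^ j) - ∑_{j < i} μ_j ι_{i-j} ^ (q ^ j))`,
`0 ≤ i ≤ deg_τ φ_X`, for the coefficients `μ_i` of `φ'_X`. -/
def IsVeluCodomain (φ : DrinfeldModule γ) (ι : Ore Fq L) (φ' : DrinfeldModule γ) : Prop :=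
  (φ'.toHom X).tdeg ≤ (φ.toHom X).tdeg ∧
  ∀ i ≤ (φ.toHom X).tdeg,
    (φ'.toHom X).coeff i =
      (ι.coeff 0 ^ (Fintype.card Fq ^ i))⁻¹ *
        (∑ j ∈ Finset.range (i + 1),
            ι.coeff j * (φ.toHom X).coeff (i - j) ^ (Fintype.card Fq ^ j)
          - ∑ j ∈ Finset.range i,
            (φ'.toHom X).coeff j * ι.coeff (i - j) ^ (Fintype.card Fq ^ j))

end DrinfeldModule

/-- `ξ = Y² + h(X) Y - f(X)` in `Fq[X][Y]` (the outer variable is `Y`). -/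
def xi (h f : Fq[X]) : Fq[X][X] := X ^ 2 + C h * X - C f

/-- The curve `Y² + h(X) Y - f(X) = 0` has no singular point in the affine plane over an
algebraic closure of `Fq`. -/
def IsSmoothAffine (h f : Fq[X]) : Prop :=
  ∀ x y : AlgebraicClosure Fq, y ^ 2 + aeval x h * y - aeval x f = 0 →
    ¬ (2 * y + aeval x h = 0 ∧ aeval x (derivative h) * y - aeval x (derivative f) = 0)

/-- The ring `A_H = Fq[X][Y] / (ξ)`. -/
abbrev CoordRing (h f : Fq[X]) : Type _ := AdjoinRoot (xi h f)

variable [FiniteDimensional Fq L] {γ : Fq[X] →ₐ[Fq] L}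

namespace DrinfeldModule

/-- The evaluation `g(X, Y) ↦ g(φ_X, τ_L)` on `Fq[X][Y]`. -/
def evalXY (φ : DrinfeldModule γ) : Fq[X][X] →+* Ore Fq L :=
  eval₂RingHom' (φ.toHom : Fq[X] →+* Ore Fq L) (Ore.tauL Fq L)
    (fun _ => Ore.commute_tauL _)

/-- `ξ = Y² + h(X) Y - f(X)` is the characteristic polynomial of the Frobenius endomorphism
of `φ` (a module of rank two). -/
structure HasFrobCharPoly (φ : DrinfeldModule γ) (h f : Fq[X]) : Prop where
  eval_eq_zero : φ.evalXY (xi h f) = 0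
  natDegree_f : f.natDegree = Module.finrank Fq L
  natDegree_h : 2 * h.natDegree ≤ Module.finrank Fq L

/-- `φ` is ordinary: in the characteristic polynomial `Y² + h Y - f` of its Frobenius
endomorphism, `h` is not in the characteristic `ker γ`. -/
def IsOrdinary (φ : DrinfeldModule γ) : Prop :=
  ∃ h f : Fq[X], φ.HasFrobCharPoly h f ∧ γ h ≠ 0

/-- `φ` belongs to `Dr_2(Fq[X], L)_ξ`. -/
structure MemDr2 (h f : Fq[X]) (φ : DrinfeldModule γ) : Prop where
  rank_two : φ.HasRank 2
  charPoly : φ.HasFrobCharPoly h f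

variable {h f : Fq[X]}

/-- The morphism `A_H → End_L(φ) ⊆ L{τ}`, `g ↦ g(φ_X, τ_L)`, for `φ` in `Dr_2(Fq[X], L)_ξ`. -/
def evalA (φ : DrinfeldModule γ) (hφ : φ.MemDr2 h f) : CoordRing h f →+* Ore Fq L :=
  Ideal.Quotient.lift (Ideal.span {xi h f}) φ.evalXY (by
    intro a ha
    obtain ⟨b, rfl⟩ := Ideal.mem_span_singleton'.1 ha
    rw [map_mul, hφ.charPoly.eval_eq_zero, mul_zero])

theorem commute_evalXY (φ : DrinfeldModule γ) (g : Fq[X][X]) (a : Fq[X]) :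
    Commute (φ.evalXY g) (φ.toHom a) := by
  have e : φ.toHom a = φ.evalXY (C a) := by
    change _ = eval₂ _ _ (C a)
    rw [eval₂_C]
    rfl
  rw [e, commute_iff_eq, ← map_mul, ← map_mul, mul_comm]

/-- The values of `evalA` are endomorphisms of `φ`. -/
theorem evalA_mem_End (φ : DrinfeldModule γ) (hφ : φ.MemDr2 h f) (g : CoordRing h f) :
    IsMorphism φ φ (φ.evalA hφ g) := by
  intro a
  obtain ⟨g, rfl⟩ := AdjoinRoot.mk_surjective g
  exact φ.commute_evalXY g a

/-- The ideal of `A_H` associated to an isogeny `ι : φ → ψ`: the ideal `Hom(ψ, φ) ι` of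
`End(φ)`, transported to `A_H` along `g ↦ g(φ_X, τ_L)`. -/
def assocIdeal (φ ψ : DrinfeldModule γ) (hφ : φ.MemDr2 h f) (ι : Ore Fq L) :
    Ideal (CoordRing h f) where
  carrier := {g | ∃ η : Ore Fq L, IsMorphism ψ φ η ∧ φ.evalA hφ g = η * ι}
  add_mem' := by
    rintro a b ⟨η, hη, ha⟩ ⟨η', hη', hb⟩
    refine ⟨η + η', fun c => ?_, ?_⟩
    · rw [add_mul, mul_add, hη c, hη' c]
    · rw [map_add, ha, hb, add_mul]
  zero_mem' := ⟨0, fun c => by simp, by simp⟩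
  smul_mem' := by
    rintro c a ⟨η, hη, ha⟩
    refine ⟨φ.evalA hφ c * η, fun b => ?_, ?_⟩
    · rw [mul_assoc, hη b, ← mul_assoc, φ.evalA_mem_End hφ c b, mul_assoc]
    · rw [smul_eq_mul, map_mul, ha, mul_assoc]

/-- `φ' = 𝔞 ⋆ φ`, with `ι𝔞 : φ → φ'` the associated isogeny: `ι𝔞` is the right-gcd of the
`g(φ_X, τ_L)`, `g ∈ 𝔞`. -/
def IsStar (φ : DrinfeldModule γ) (hφ : φ.MemDr2 h f) (𝔞 : Ideal (CoordRing h f))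
    (ι𝔞 : Ore Fq L) (φ' : DrinfeldModule γ) : Prop :=
  Ore.IsRgcd (φ.evalA hφ '' (𝔞 : Set (CoordRing h f))) ι𝔞 ∧ IsIsogeny φ φ' ι𝔞

end DrinfeldModule

/-! ## The algorithm -/

/-- `v` is a possible output of `PrimeIsogenyToPrimeIdeal(φ, ι, r)`: with `y` the remainder of
`τ_L`, and `ρ i` the remainder of `φ_{X^i}` (`i < deg r`), in the right-divisions by `ι`, the
linear system `y - ∑ v_i ρ_i = 0` is solved for `v_i ∈ Fq`, and `v = ∑ v_i X^i`. -/
def PrimeIsogenyToPrimeIdeal (φ : DrinfeldModule γ) (ι : Ore Fq L) (r v : Fq[X]) : Prop :=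
  ∃ (y : Ore Fq L) (ρ : Fin r.natDegree → Ore Fq L) (c : Fin r.natDegree → Fq),
    Ore.IsRightRem (Ore.tauL Fq L) ι y ∧
    (∀ i : Fin r.natDegree, Ore.IsRightRem (φ.toHom (X ^ (i : ℕ))) ι (ρ i)) ∧
    y - ∑ i, c i • ρ i = 0 ∧
    v = ∑ i, C (c i) * X ^ (i : ℕ)

/-- The arguments of a call of the algorithm. -/
structure Args (γ : Fq[X] →ₐ[Fq] L) where
  φ : DrinfeldModule γ
  ι : Ore Fq L
  u : Fq[X]

/-- `r` is a monic prime factor of `u`. -/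
def IsPrimeFactor (r u : Fq[X]) : Prop := r.Monic ∧ Irreducible r ∧ r ∣ u

variable (h f : Fq[X])

/-- `CallStep h f s r J s'`: the call of `IsogenyToIdeal` with arguments `s` in which the monic
prime factor `r` is chosen returns `J` times the result of the recursive call with arguments
`s'`. The three constructors are the three branches of the algorithm, `ι'` being the exact
right-quotient of `ι`. -/
inductive CallStep : Args γ → Fq[X] → Ideal (CoordRing h f) → Args γ → Prop
  | coprime (φ : DrinfeldModule γ) (ι : Ore Fq L) (u r : Fq[X])
      (hu : u ≠ 1) (hr : IsPrimeFactor r u)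
      (hgcd : Ore.IsRgcd {ι, φ.toHom r} 1) :
      CallStep ⟨φ, ι, u⟩ r ⊤ ⟨φ, ι, u / r ^ multiplicity r u⟩
  | full (φ : DrinfeldModule γ) (ι : Ore Fq L) (u r : Fq[X])
      (hu : u ≠ 1) (hr : IsPrimeFactor r u)
      (ιt : Ore Fq L) (hgcd : Ore.IsRgcd {ι, φ.toHom r} ιt) (hne : ιt ≠ 1)
      (hfull : ∃ c : L, c ≠ 0 ∧ ιt = Ore.C c * φ.toHom r)
      (ι' : Ore Fq L) (hι' : ι = ι' * φ.toHom r) :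
      CallStep ⟨φ, ι, u⟩ r (Ideal.span {AdjoinRoot.of (xi h f) r}) ⟨φ, ι', u / r⟩
  | proper (φ : DrinfeldModule γ) (ι : Ore Fq L) (u r : Fq[X])
      (hu : u ≠ 1) (hr : IsPrimeFactor r u)
      (ιt : Ore Fq L) (hgcd : Ore.IsRgcd {ι, φ.toHom r} ιt) (hne : ιt ≠ 1)
      (hproper : ¬ ∃ c : L, c ≠ 0 ∧ ιt = Ore.C c * φ.toHom r)
      (v : Fq[X]) (hv : PrimeIsogenyToPrimeIdeal φ ιt r v)
      (φt : DrinfeldModule γ) (hφt : φ.IsVeluCodomain ιt φt)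
      (ι' : Ore Fq L) (hι' : ι = ι' * ιt) :
      CallStep ⟨φ, ι, u⟩ r
        (Ideal.span {AdjoinRoot.of (xi h f) r,
          AdjoinRoot.root (xi h f) - AdjoinRoot.of (xi h f) v})
        ⟨φt, ι', u / r⟩

/-- `Terminates h f s`: whatever choices are made during the execution (of the prime factors
and of the solutions of the linear systems), `IsogenyToIdeal` stops after finitely many
recursive calls when called with the arguments `s`, and each of its instructions can be carried
out, for every choice of the prime factor. -/
inductive Terminates : Args γ → Prop
  | intro (s : Args γ)
      (progress : s.u ≠ 1 → (∃ r, IsPrimeFactor r s.u) ∧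
        ∀ r, IsPrimeFactor r s.u → ∃ J s', CallStep h f s r J s')
      (recur : ∀ r J s', CallStep h f s r J s' → Terminates s') :
      Terminates s

/-- `Returns h f s 𝔞`: the ideal `𝔞` is a possible result of `IsogenyToIdeal` when called with
the arguments `s`. -/
inductive Returns : Args γ → Ideal (CoordRing h f) → Prop
  | base (φ : DrinfeldModule γ) (ι : Ore Fq L) : Returns ⟨φ, ι, 1⟩ ⊤
  | recur (s : Args γ) (r : Fq[X]) (J : Ideal (CoordRing h f)) (s' : Args γ)
      (I : Ideal (CoordRing h f)) (hs : CallStep h f s r J s') (hI : Returns s' I) :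
      Returns s (J * I)

end Drinfeld

end

set_option linter.unusedSectionVars false

noncomputable section

/-! ### Arithmetic of `L{τ}`: coefficients, degree, right division, right-gcd. -/

section

/-! A call with prime factor `r` splits `ι = η κ`, where `κ` is 1, `φ_r` or, in the proper case, the
right-gcd of `ι` and `φ_r`. In the proper case the kernel of `κ` in an algebraic closure is a line
over `Fq[X]/(r)`, so the Frobenius acts on it as a scalar `v`, and `κ` right-divides both `φ_r` and
`τ_L - φ_v` (`exists_tdeg_eq_natDegree_mul`). These two even generate the left ideal of `κ`
(`MemDr2.span_eq`): otherwise their right-gcd would be `φ_r` up to a constant, but `φ_r` never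
right-divides `τ_L - φ_v` (`MemDr2.not_rightDvd_tauL_sub`).

The heart is multiplicativity: the ideal of `η κ` is `P = (r, Y - v)` times the ideal of `η`
(`MemDr2.assocIdeal_mul`). One inclusion is formal; the other rests on the invertibility of `P`,
made explicit through the conjugate `-h - Y - v` of `Y - v`. Smoothness enters through
`IsSmoothAffine.not_sq_dvd`: `r ∣ 2v + h` and `r² ∣ v² + hv - f` never hold together.

Each call lowers the degree of `u`, whence termination. Two facts travel back up the recursion
(`CallStep.spec`): the result is the associated ideal, and `ι` lies in the left ideal generated by
its values. As `ι` right-divides all these values, the second fact identifies `ι` as their right-gcd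
up to a constant. -/

theorem add_pow_card_pow (Fq : Type*) {A : Type*} [Field Fq] [Fintype Fq] [CommRing A]
    [Algebra Fq A] (x y : A) (j : ℕ) :
    (x + y) ^ (Fintype.card Fq ^ j) =
      x ^ (Fintype.card Fq ^ j) + y ^ (Fintype.card Fq ^ j) := by
  induction j with
  | zero => simp
  | succ j ih =>
    rw [pow_succ, pow_mul, ih, pow_mul, pow_mul]
    exact map_add (FiniteField.frobeniusAlgHom Fq A) _ _

namespace Ore

variable {Fq L : Type*} [Field Fq] [Fintype Fq] [Field L] [Algebra Fq L]

theorem ext {P Q : Ore Fq L} (h : ∀ n, P.coeff n = Q.coeff n) : P = Q :=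
  SkewPolynomial.ext h

@[simp] theorem coeff_zero (n : ℕ) : (0 : Ore Fq L).coeff n = 0 := rfl

@[simp] theorem coeff_add (P Q : Ore Fq L) (n : ℕ) :
    (P + Q).coeff n = P.coeff n + Q.coeff n :=
  SkewPolynomial.coeff_add _ _ n

@[simp] theorem coeff_sub (P Q : Ore Fq L) (n : ℕ) :
    (P - Q).coeff n = P.coeff n - Q.coeff n :=
  SkewPolynomial.coeff_sub _ _ n

theorem C_mul_tau_pow (a : L) (n : ℕ) :
    (C a * tau ^ n : Ore Fq L) = (SkewPolynomial.monomial n a : SkewPolynomial L) := by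
  let _ := frobAction Fq L
  exact @SkewPolynomial.C_mul_X_pow_eq_monomial L _ a _ n

theorem coeff_C_mul_tau_pow (a : L) (n k : ℕ) :
    (C a * tau ^ n : Ore Fq L).coeff k = if n = k then a else 0 := by
  rw [C_mul_tau_pow]
  exact SkewPolynomial.coeff_monomial

theorem coeff_C (a : L) (k : ℕ) : (C a : Ore Fq L).coeff k = if 0 = k then a else 0 := by
  simpa using coeff_C_mul_tau_pow (Fq := Fq) a 0 k

@[simp] theorem coeff_C_zero (a : L) : (C a : Ore Fq L).coeff 0 = a := by simp [coeff_C]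

theorem coeff_one (k : ℕ) : (1 : Ore Fq L).coeff k = if 0 = k then 1 else 0 := by
  simpa using coeff_C (Fq := Fq) (1 : L) k

/-- The coefficient of index `n`, as an additive map. -/
def coeffHom (n : ℕ) : Ore Fq L →+ L :=
  AddMonoidHom.mk' (fun P => P.coeff n) fun P Q => coeff_add P Q n

theorem coeff_sum {ι : Type*} (s : Finset ι) (P : ι → Ore Fq L) (n : ℕ) :
    (∑ i ∈ s, P i).coeff n = ∑ i ∈ s, (P i).coeff n :=
  map_sum (coeffHom n) P s

theorem coeff_mul (P Q : Ore Fq L) (k : ℕ) :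
    (P * Q).coeff k =
      ∑ j ∈ Finset.range (k + 1), P.coeff j * Q.coeff (k - j) ^ (Fintype.card Fq ^ j) := by
  have hq := fun x y : L => add_pow_card_pow Fq x y
  induction P using Ore.induction with
  | h0 => simp
  | hadd P P' hP hP' => simp [add_mul, hP, hP', Finset.sum_add_distrib]
  | hmon a n =>
    induction Q using Ore.induction with
    | h0 => simp
    | hadd Q Q' hQ hQ' => simp [mul_add, hQ, hQ', Finset.sum_add_distrib, hq]
    | hmon b m =>
      have e : (C a * tau ^ n * (C b * tau ^ m) : Ore Fq L) =
          C (a * b ^ (Fintype.card Fq ^ n)) * tau ^ (n + m) := by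
        rw [mul_assoc, ← mul_assoc (tau ^ n), tau_pow_mul_C, map_mul, pow_add]
        simp only [mul_assoc]
      rw [e]
      simp only [coeff_C_mul_tau_pow]
      by_cases h : n + m = k
      · rw [if_pos h, Finset.sum_eq_single n]
        · rw [if_pos rfl, if_pos (by omega)]
        · intro j _ hj; rw [if_neg (Ne.symm hj), zero_mul]
        · intro hn; simp at hn; omega
      · rw [if_neg h, eq_comm]
        refine Finset.sum_eq_zero fun j hj => ?_
        split_ifs with h1 h2
        · simp at hj; omega
        · rw [zero_pow (pow_ne_zero _ Fintype.card_ne_zero), mul_zero]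
        · simp
        · simp

theorem coeff_mul_zero (P Q : Ore Fq L) : (P * Q).coeff 0 = P.coeff 0 * Q.coeff 0 := by
  simp [coeff_mul]

theorem le_tdeg {P : Ore Fq L} {n : ℕ} (h : P.coeff n ≠ 0) : n ≤ P.tdeg :=
  Finset.le_sup (f := id) (SkewPolynomial.mem_support_iff.2 h)

theorem coeff_eq_zero_of_tdeg_lt {P : Ore Fq L} {n : ℕ} (h : P.tdeg < n) : P.coeff n = 0 := by
  by_contra h'
  exact absurd (le_tdeg h') (by omega)

theorem coeff_tdeg_ne_zero {P : Ore Fq L} (h : P ≠ 0) : P.coeff P.tdeg ≠ 0 := by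
  have hs : (SkewPolynomial.support (P : SkewPolynomial L)).Nonempty := by
    rw [Finset.nonempty_iff_ne_empty]
    intro h'
    exact h (SkewPolynomial.support_eq_empty.1 h')
  obtain ⟨n, hn, hn'⟩ := Finset.exists_mem_eq_sup _ hs id
  have : P.tdeg = n := hn'
  rw [this]
  exact SkewPolynomial.mem_support_iff.1 hn

theorem tdeg_le {P : Ore Fq L} {n : ℕ} (h : ∀ k, n < k → P.coeff k = 0) : P.tdeg ≤ n := by
  refine Finset.sup_le fun k hk => ?_
  by_contra h'
  exact SkewPolynomial.mem_support_iff.1 hk (h k (by simpa using h'))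

theorem tdeg_lt {P : Ore Fq L} {n : ℕ} (h0 : P ≠ 0) (h : ∀ k, n ≤ k → P.coeff k = 0) :
    P.tdeg < n := by
  by_contra h'
  exact coeff_tdeg_ne_zero h0 (h _ (by omega))

theorem tdeg_eq {P : Ore Fq L} {n : ℕ} (h : ∀ k, n < k → P.coeff k = 0) (hn : P.coeff n ≠ 0) :
    P.tdeg = n :=
  le_antisymm (tdeg_le h) (le_tdeg hn)

theorem tdeg_C (a : L) : (C a : Ore Fq L).tdeg = 0 := by
  refine Nat.le_zero.1 (tdeg_le fun k hk => ?_)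
  rw [coeff_C, if_neg (by omega)]

theorem tdeg_tau_pow (n : ℕ) : (tau ^ n : Ore Fq L).tdeg = n := by
  have h := coeff_C_mul_tau_pow (Fq := Fq) (1 : L) n
  rw [map_one, one_mul] at h
  exact tdeg_eq (fun k hk => by rw [h, if_neg (by omega)]) (by simp [h])

theorem eq_C_of_tdeg_eq_zero {P : Ore Fq L} (h : P.tdeg = 0) : P = C (P.coeff 0) := by
  refine ext fun n => ?_
  rw [coeff_C]
  split_ifs with hn
  · rw [hn]
  · exact coeff_eq_zero_of_tdeg_lt (by omega)

theorem coeff_mul_tdeg_add (P Q : Ore Fq L) :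
    (P * Q).coeff (P.tdeg + Q.tdeg) =
      P.coeff P.tdeg * Q.coeff Q.tdeg ^ (Fintype.card Fq ^ P.tdeg) := by
  rw [coeff_mul, Finset.sum_eq_single P.tdeg]
  · rw [Nat.add_sub_cancel_left]
  · intro j _ hj
    rcases lt_or_gt_of_ne hj with h | h
    · rw [coeff_eq_zero_of_tdeg_lt (P := Q) (by omega),
        zero_pow (pow_ne_zero _ Fintype.card_ne_zero), mul_zero]
    · rw [coeff_eq_zero_of_tdeg_lt h, zero_mul]
  · intro h; simp at h

theorem coeff_mul_of_lt {P Q : Ore Fq L} {k : ℕ} (h : P.tdeg + Q.tdeg < k) :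
    (P * Q).coeff k = 0 := by
  rw [coeff_mul]
  refine Finset.sum_eq_zero fun j _ => ?_
  by_cases hj : P.tdeg < j
  · rw [coeff_eq_zero_of_tdeg_lt hj, zero_mul]
  · rw [coeff_eq_zero_of_tdeg_lt (P := Q) (by omega),
      zero_pow (pow_ne_zero _ Fintype.card_ne_zero), mul_zero]

theorem coeff_mul_tdeg_add_ne_zero {P Q : Ore Fq L} (hP : P ≠ 0) (hQ : Q ≠ 0) :
    (P * Q).coeff (P.tdeg + Q.tdeg) ≠ 0 := by
  rw [coeff_mul_tdeg_add]
  exact mul_ne_zero (coeff_tdeg_ne_zero hP) (pow_ne_zero _ (coeff_tdeg_ne_zero hQ))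

theorem tdeg_mul {P Q : Ore Fq L} (hP : P ≠ 0) (hQ : Q ≠ 0) :
    (P * Q).tdeg = P.tdeg + Q.tdeg :=
  tdeg_eq (fun _ => coeff_mul_of_lt) (coeff_mul_tdeg_add_ne_zero hP hQ)

instance : Nontrivial (Ore Fq L) :=
  ⟨⟨0, 1, fun h => by simpa [coeff_one] using congrArg (fun P => coeff P 0) h⟩⟩

instance : NoZeroDivisors (Ore Fq L) where
  eq_zero_or_eq_zero_of_mul_eq_zero := by
    intro P Q h
    by_contra! h'
    exact coeff_mul_tdeg_add_ne_zero h'.1 h'.2 (by rw [h, coeff_zero])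

instance : IsDomain (Ore Fq L) := NoZeroDivisors.to_isDomain _

theorem IsSeparable.ne_zero {P : Ore Fq L} (h : P.IsSeparable) : P ≠ 0 := by
  rintro rfl
  exact h rfl

theorem C_ne_zero {a : L} (ha : a ≠ 0) : (C a : Ore Fq L) ≠ 0 :=
  IsSeparable.ne_zero (by simpa [IsSeparable] using ha)

theorem C_inv_mul_C {a : L} (ha : a ≠ 0) : (C a⁻¹ * C a : Ore Fq L) = 1 := by
  rw [← map_mul, inv_mul_cancel₀ ha, map_one]

theorem exists_rightRem (P : Ore Fq L) {Q : Ore Fq L} (hQ : Q ≠ 0) : ∃ R, IsRightRem P Q R := by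
  generalize hn : P.tdeg = n
  induction n using Nat.strong_induction_on generalizing P with
  | _ n ih =>
    by_cases hlt : P.tdeg < Q.tdeg
    · exact ⟨P, ⟨0, by simp⟩, Or.inr hlt⟩
    by_cases hP : P = 0
    · exact ⟨0, ⟨0, by simp [hP]⟩, Or.inl rfl⟩
    set k := P.tdeg - Q.tdeg with hk
    -- The leading coefficient of `a τ^k Q` is `a` times the `q^k`-th power of that of `Q`; dividing
    -- on this side requires no `q`-th roots in `L`.
    set a : L := P.coeff P.tdeg * (Q.coeff Q.tdeg ^ (Fintype.card Fq ^ k))⁻¹ with ha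
    have ha0 : a ≠ 0 := mul_ne_zero (coeff_tdeg_ne_zero hP)
      (inv_ne_zero (pow_ne_zero _ (coeff_tdeg_ne_zero hQ)))
    set M : Ore Fq L := C a * tau ^ k with hM
    have hMk : M.tdeg = k :=
      tdeg_eq (fun j hj => by rw [hM, coeff_C_mul_tau_pow, if_neg (by omega)])
        (by rw [hM, coeff_C_mul_tau_pow, if_pos rfl]; exact ha0)
    have hMc : M.coeff k = a := by rw [hM, coeff_C_mul_tau_pow, if_pos rfl]
    set P' := P - M * Q with hP'
    have hlead : (M * Q).coeff P.tdeg = P.coeff P.tdeg := by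
      have h1 := coeff_mul_tdeg_add M Q
      rw [hMk, show k + Q.tdeg = P.tdeg by omega, hMc] at h1
      rw [h1, ha, mul_assoc, inv_mul_cancel₀ (pow_ne_zero _ (coeff_tdeg_ne_zero hQ)), mul_one]
    by_cases hP'0 : P' = 0
    · exact ⟨0, ⟨M, by rw [add_zero]; exact sub_eq_zero.1 hP'0⟩, Or.inl rfl⟩
    have hdeg : P'.tdeg < n := by
      refine tdeg_lt hP'0 fun j hj => ?_
      rw [hP', coeff_sub]
      rcases hj.eq_or_lt with rfl | h
      · rw [← hn, hlead, sub_self]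
      · rw [coeff_eq_zero_of_tdeg_lt (by omega), coeff_mul_of_lt (by omega), sub_zero]
    obtain ⟨R, ⟨W, hW⟩, hR⟩ := ih _ hdeg P' rfl
    refine ⟨R, ⟨W + M, ?_⟩, hR⟩
    rw [add_mul, add_right_comm, ← hW, hP', sub_add_cancel]

theorem mem_span_singleton {P Q : Ore Fq L} :
    P ∈ (Ideal.span {Q} : Ideal (Ore Fq L)) ↔ Q.RightDvd P := by
  rw [Ideal.span, Submodule.mem_span_singleton]
  exact ⟨fun ⟨W, hW⟩ => ⟨W, hW.symm⟩, fun ⟨W, hW⟩ => ⟨W, hW.symm⟩⟩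

theorem mem_span_pair {P Q R : Ore Fq L} :
    R ∈ (Ideal.span {P, Q} : Ideal (Ore Fq L)) ↔ ∃ A B, R = A * P + B * Q := by
  rw [Ideal.span, Submodule.mem_span_pair]
  exact ⟨fun ⟨A, B, h⟩ => ⟨A, B, h.symm⟩, fun ⟨A, B, h⟩ => ⟨A, B, h.symm⟩⟩

theorem isMonic_C_inv_mul {P : Ore Fq L} (hP : P ≠ 0) :
    (C (P.coeff P.tdeg)⁻¹ * P).IsMonic := by
  have h0 := coeff_tdeg_ne_zero hP
  have hC : (C (P.coeff P.tdeg)⁻¹ : Ore Fq L) ≠ 0 := C_ne_zero (inv_ne_zero h0)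
  rw [IsMonic, tdeg_mul hC hP, coeff_mul_tdeg_add, tdeg_C]
  simp [h0]

theorem span_C_mul {a : L} (ha : a ≠ 0) (P : Ore Fq L) :
    (Ideal.span {C a * P} : Ideal (Ore Fq L)) = Ideal.span {P} := by
  refine le_antisymm ?_ ?_ <;>
    rw [Ideal.span_le, Set.singleton_subset_iff, SetLike.mem_coe, mem_span_singleton]
  · exact ⟨_, rfl⟩
  · exact ⟨C a⁻¹, by rw [← mul_assoc, C_inv_mul_C ha, one_mul]⟩

/-- Right division makes a nonzero element of least degree a generator of the left ideal; a constant
factor then makes it monic. -/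
theorem exists_isRgcd {S : Set (Ore Fq L)} (hS : ∃ P ∈ S, P ≠ 0) : ∃ g, IsRgcd S g := by
  classical
  obtain ⟨P, hP, hP0⟩ := hS
  have hex : ∃ n, ∃ Q ∈ (Ideal.span S : Ideal (Ore Fq L)), Q ≠ 0 ∧ Q.tdeg = n :=
    ⟨_, P, Ideal.subset_span hP, hP0, rfl⟩
  obtain ⟨Q, hQ, hQ0, hQn⟩ := Nat.find_spec hex
  refine ⟨C (Q.coeff Q.tdeg)⁻¹ * Q, isMonic_C_inv_mul hQ0, ?_⟩
  rw [span_C_mul (inv_ne_zero (coeff_tdeg_ne_zero hQ0))]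
  refine le_antisymm (fun T hT => mem_span_singleton.2 ?_) ?_
  · obtain ⟨R, ⟨W, hW⟩, hR⟩ := exists_rightRem T hQ0
    rcases hR with rfl | hR
    · exact ⟨W, by rw [hW, add_zero]⟩
    -- Zero has `tdeg` 0, so the degree bound alone does not exclude `R = 0`.
    by_cases hR0 : R = 0
    · exact ⟨W, by rw [hW, hR0, add_zero]⟩
    refine absurd ⟨R, ?_, hR0, rfl⟩ (Nat.find_min hex (hR.trans_eq hQn))
    rw [show R = T - W * Q by rw [hW, add_sub_cancel_left]]
    exact sub_mem hT (Ideal.mul_mem_left _ _ hQ)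
  · rw [Ideal.span_le, Set.singleton_subset_iff]
    exact hQ

theorem IsRgcd.ne_zero {S : Set (Ore Fq L)} {g : Ore Fq L} (h : IsRgcd S g) : g ≠ 0 := by
  rintro rfl
  have := h.1
  rw [IsMonic, coeff_zero] at this
  exact zero_ne_one this

theorem IsRgcd.rightDvd {S : Set (Ore Fq L)} {g P : Ore Fq L} (h : IsRgcd S g) (hP : P ∈ S) :
    g.RightDvd P :=
  mem_span_singleton.1 (h.2 ▸ Ideal.subset_span hP)

theorem IsRgcd.exists_eq {P Q g : Ore Fq L} (h : IsRgcd {P, Q} g) :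
    ∃ A B, g = A * P + B * Q :=
  mem_span_pair.1 (h.2 ▸ Ideal.subset_span rfl)

theorem RightDvd.tdeg_le {P Q : Ore Fq L} (h : P.RightDvd Q) (hQ : Q ≠ 0) : P.tdeg ≤ Q.tdeg := by
  obtain ⟨W, rfl⟩ := h
  rw [tdeg_mul (left_ne_zero_of_mul hQ) (right_ne_zero_of_mul hQ)]
  omega

theorem RightDvd.exists_C {P Q : Ore Fq L} (h : P.RightDvd Q) (hQ : Q ≠ 0)
    (hd : P.tdeg = Q.tdeg) : ∃ c : L, c ≠ 0 ∧ P = C c * Q := by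
  obtain ⟨W, rfl⟩ := h
  have hW := left_ne_zero_of_mul hQ
  rw [tdeg_mul hW (right_ne_zero_of_mul hQ)] at hd
  have e := eq_C_of_tdeg_eq_zero (show W.tdeg = 0 by omega)
  have h0 : W.coeff 0 ≠ 0 := by
    intro h0
    rw [h0, map_zero] at e
    exact hW e
  exact ⟨(W.coeff 0)⁻¹, inv_ne_zero h0, by rw [e, coeff_C_zero, ← mul_assoc, C_inv_mul_C h0, one_mul]⟩

theorem RightDvd.trans {P Q R : Ore Fq L} (h : P.RightDvd Q) (h' : Q.RightDvd R) :
    P.RightDvd R := by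
  obtain ⟨A, rfl⟩ := h
  obtain ⟨B, rfl⟩ := h'
  exact ⟨B * A, by rw [mul_assoc]⟩

theorem RightDvd.add {P Q R : Ore Fq L} (h : P.RightDvd Q) (h' : P.RightDvd R) :
    P.RightDvd (Q + R) := by
  rw [← mem_span_singleton] at *
  exact add_mem h h'

theorem RightDvd.sub {P Q R : Ore Fq L} (h : P.RightDvd Q) (h' : P.RightDvd R) :
    P.RightDvd (Q - R) := by
  rw [← mem_span_singleton] at *
  exact sub_mem h h'

theorem RightDvd.mul_left {P Q : Ore Fq L} (h : P.RightDvd Q) (R : Ore Fq L) :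
    P.RightDvd (R * Q) := by
  rw [← mem_span_singleton] at *
  exact Ideal.mul_mem_left _ _ h

theorem RightDvd.isSeparable {P Q : Ore Fq L} (h : P.RightDvd Q) (hQ : Q.IsSeparable) :
    P.IsSeparable := by
  obtain ⟨W, rfl⟩ := h
  rw [IsSeparable, coeff_mul_zero] at hQ
  exact right_ne_zero_of_mul hQ

end Ore

end

/-! ### The action of `L{τ}` on extension fields; kernels and divisibility. -/

section

namespace Ore

variable {Fq L : Type*} [Field Fq] [Fintype Fq] [Field L] [Algebra Fq L]

section Action

variable (K : Type*) [Field K] [Algebra L K]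

/-- The `q`-Frobenius, as an endomorphism of the additive group of `K`. -/
def frobEnd (Fq L : Type*) (K : Type*) [Field Fq] [Fintype Fq] [Field L] [Algebra Fq L]
    [Field K] [Algebra L K] : AddMonoid.End K :=
  letI : Algebra Fq K := ((algebraMap L K).comp (algebraMap Fq L)).toAlgebra
  (AddMonoidHom.mk' (fun x : K => x ^ Fintype.card Fq) fun x y => by
    simpa using add_pow_card_pow Fq x y 1 : K →+ K)

theorem frobEnd_pow_apply (n : ℕ) (x : K) :
    (frobEnd Fq L K ^ n) x = x ^ (Fintype.card Fq ^ n) := by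
  induction n generalizing x with
  | zero => simp
  | succ n ih =>
    rw [pow_succ, pow_succ', pow_mul]
    exact ih _

/-- The action of `L{τ}` on an extension `K` of `L`, in which `τ` acts as `x ↦ x ^ q`. -/
def act : Ore Fq L →+* AddMonoid.End K :=
  letI := frobAction Fq L
  SkewMonoidAlgebra.liftNCRingHom (k := L) (G := Multiplicative ℕ)
    ((Module.toAddMonoidEnd K K).comp (algebraMap L K))
    (powersHom (AddMonoid.End K) (frobEnd Fq L K)) (by
      intro x y
      ext z
      -- The action is identified by computing `τ^n x` in two ways and comparing the coefficients of
      -- `τ^n`.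
      have h : y • x = x ^ (Fintype.card Fq ^ y.toAdd) := by
        have h1 := Ore.tau_pow_mul_C (Fq := Fq) y.toAdd x
        have h2 : (Ore.tau : Ore Fq L) ^ y.toAdd * Ore.C x = Ore.C (y • x) * Ore.tau ^ y.toAdd := by
          have h3 : (SkewPolynomial.monomial y.toAdd (1 : L) : SkewPolynomial L) *
              SkewPolynomial.C x = SkewPolynomial.monomial y.toAdd (y • x) := by
            rw [SkewPolynomial.monomial_mul_C, one_mul, SkewPolynomial.φ_iterate_apply]
            rfl
          rw [C_mul_tau_pow, ← h3]
          have h4 := C_mul_tau_pow (Fq := Fq) (1 : L) y.toAdd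
          rw [map_one, one_mul] at h4
          rw [h4]
          rfl
        have h5 := congrArg (fun P => Ore.coeff P y.toAdd) (h2.symm.trans h1)
        simpa only [coeff_C_mul_tau_pow, if_true] using h5
      rw [h]
      change algebraMap L K (x ^ (Fintype.card Fq ^ y.toAdd)) * (frobEnd Fq L K ^ y.toAdd) z =
        (frobEnd Fq L K ^ y.toAdd) (algebraMap L K x * z)
      rw [frobEnd_pow_apply, frobEnd_pow_apply, mul_pow, map_pow])

@[simp] theorem act_mul (P Q : Ore Fq L) (x : K) : act K (P * Q) x = act K P (act K Q x) := by
  rw [map_mul]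
  rfl

@[simp] theorem act_add (P Q : Ore Fq L) (x : K) : act K (P + Q) x = act K P x + act K Q x := by
  rw [map_add]
  rfl

@[simp] theorem act_sub (P Q : Ore Fq L) (x : K) : act K (P - Q) x = act K P x - act K Q x := by
  rw [map_sub]
  rfl

theorem act_C_mul_tau_pow (a : L) (n : ℕ) (x : K) :
    act K (C a * tau ^ n : Ore Fq L) x = algebraMap L K a * x ^ (Fintype.card Fq ^ n) := by
  let _ := frobAction Fq L
  have h : act K (C a * tau ^ n : Ore Fq L) =
      (Module.toAddMonoidEnd K K (algebraMap L K a)) * frobEnd Fq L K ^ n := by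
    rw [C_mul_tau_pow]
    exact SkewMonoidAlgebra.liftNC_single _ _ _ _
  rw [h, ← frobEnd_pow_apply (Fq := Fq) (L := L)]
  rfl

theorem act_sum {ι : Type*} (s : Finset ι) (P : ι → Ore Fq L) (x : K) :
    act K (∑ i ∈ s, P i) x = ∑ i ∈ s, act K (P i) x := by
  classical
  induction s using Finset.induction_on with
  | empty => simp
  | insert i s hi ih => rw [Finset.sum_insert hi, Finset.sum_insert hi, act_add, ih]

/-- The polynomial `∑ a_n X ^ (q ^ n)` of an Ore polynomial `∑ a_n τ ^ n`. -/
def lin (P : Ore Fq L) : L[X] :=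
  ∑ n ∈ Finset.range (P.tdeg + 1), Polynomial.C (P.coeff n) * X ^ (Fintype.card Fq ^ n)

theorem eq_sum (P : Ore Fq L) :
    P = ∑ n ∈ Finset.range (P.tdeg + 1), C (P.coeff n) * tau ^ n := by
  refine ext fun k => ?_
  simp only [coeff_sum, coeff_C_mul_tau_pow, Finset.sum_ite_eq', Finset.mem_range]
  split_ifs with h
  · rfl
  · exact coeff_eq_zero_of_tdeg_lt (by omega)

theorem aeval_lin (P : Ore Fq L) (x : K) : aeval x P.lin = act K P x := by
  conv_rhs => rw [P.eq_sum, act_sum]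
  simp only [act_C_mul_tau_pow]
  simp only [lin, map_sum, map_mul, aeval_C, map_pow, aeval_X]

end Action
theorem coeff_lin (P : Ore Fq L) (n : ℕ) : P.lin.coeff (Fintype.card Fq ^ n) = P.coeff n := by
  have h := Nat.pow_right_injective (Fintype.one_lt_card (α := Fq))
  simp only [lin, finsetSum_coeff, coeff_C_mul, coeff_X_pow, h.eq_iff]
  simp only [mul_ite, mul_one, mul_zero, Finset.sum_ite_eq, Finset.mem_range]
  split_ifs with h
  · rfl
  · exact (coeff_eq_zero_of_tdeg_lt (by omega)).symm

theorem natDegree_lin {P : Ore Fq L} (hP : P ≠ 0) :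
    P.lin.natDegree = Fintype.card Fq ^ P.tdeg := by
  refine le_antisymm ?_ (le_natDegree_of_ne_zero ?_)
  · refine natDegree_sum_le_of_forall_le _ _ fun n hn => (natDegree_C_mul_X_pow_le _ _).trans ?_
    exact Nat.pow_le_pow_right Fintype.card_pos (by simpa [Nat.lt_succ_iff] using hn)
  · rw [coeff_lin]
    exact coeff_tdeg_ne_zero hP

theorem lin_ne_zero {P : Ore Fq L} (hP : P ≠ 0) : P.lin ≠ 0 := by
  intro h
  have := P.coeff_lin P.tdeg
  rw [h] at this
  exact coeff_tdeg_ne_zero hP this.symm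

/-- Every exponent `q^n` with `n > 0` vanishes in `L`. So a nonzero constant term of the Ore
polynomial makes all roots simple. -/
theorem derivative_lin (P : Ore Fq L) : derivative P.lin = Polynomial.C (P.coeff 0) := by
  have hq : (Fintype.card Fq : L) = 0 := by
    rw [← map_natCast (algebraMap Fq L), FiniteField.cast_card_eq_zero, map_zero]
  rw [lin, derivative_sum, Finset.sum_eq_single 0]
  · simp
  · intro n _ hn
    simp [derivative_X_pow, hq, hn]
  · simp

theorem separable_lin {P : Ore Fq L} (hP : P.IsSeparable) : P.lin.Separable := by
  rw [Polynomial.Separable, derivative_lin]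
  exact isCoprime_one_right.of_isCoprime_of_dvd_right
    ((isUnit_C.2 (isUnit_iff_ne_zero.2 hP)).dvd)

section Kernel

variable (K : Type*) [Field K] [Algebra L K]

/-- The kernel of an Ore polynomial in an extension of `L`. -/
def ker (P : Ore Fq L) : AddSubgroup K := AddMonoidHom.ker (act K P : K →+ K)

theorem mem_ker {P : Ore Fq L} {x : K} : x ∈ P.ker K ↔ act K P x = 0 := AddMonoidHom.mem_ker

theorem coe_ker {P : Ore Fq L} (hP : P ≠ 0) : (P.ker K : Set K) = P.lin.rootSet K := by
  ext x
  rw [mem_rootSet_of_ne (lin_ne_zero hP), aeval_lin, SetLike.mem_coe, mem_ker]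

theorem natCard_ker [IsAlgClosed K] {P : Ore Fq L} (hP : P.IsSeparable) :
    Nat.card (P.ker K) = Fintype.card Fq ^ P.tdeg := by
  have h := card_rootSet_eq_natDegree (K := K) (separable_lin hP) (IsAlgClosed.splits _)
  rw [natDegree_lin hP.ne_zero, ← Nat.card_eq_fintype_card, ← coe_ker K hP.ne_zero] at h
  exact h

theorem finite_ker {P : Ore Fq L} (hP : P ≠ 0) : Finite (P.ker K) := by
  have : ((P.ker K : Set K)).Finite := by rw [coe_ker K hP]; exact rootSet_finite _ _
  exact this

theorem RightDvd.ker_le {P Q : Ore Fq L} (h : P.RightDvd Q) : P.ker K ≤ Q.ker K := by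
  obtain ⟨W, rfl⟩ := h
  intro x hx
  rw [mem_ker] at *
  rw [act_mul, hx, map_zero]

/-- The remainder of `Q` by `P` vanishes on the kernel of `P`, which has `q^(deg P)` elements: too
many roots for a nonzero remainder. -/
theorem rightDvd_of_ker_le [IsAlgClosed K] {P Q : Ore Fq L} (hP : P.IsSeparable)
    (h : P.ker K ≤ Q.ker K) : P.RightDvd Q := by
  obtain ⟨R, ⟨W, hW⟩, hR⟩ := exists_rightRem Q hP.ne_zero
  suffices hR0 : R = 0 from ⟨W, by rw [hW, hR0, add_zero]⟩
  by_contra hR0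
  have hlt := hR.resolve_left hR0
  have hle : (P.ker K : Set K) ⊆ R.lin.rootSet K := by
    rw [← coe_ker K hR0]
    intro x hx
    have hQ := h hx
    rw [SetLike.mem_coe, mem_ker] at *
    rwa [hW, act_add, act_mul, hx, map_zero, zero_add] at hQ
  have h1 : Fintype.card Fq ^ P.tdeg ≤ Fintype.card Fq ^ R.tdeg := by
    rw [← natCard_ker K hP, ← natDegree_lin hR0]
    refine (Nat.card_mono (rootSet_finite _ _) hle).trans ?_
    rw [Nat.card_coe_set_eq]
    exact ncard_rootSet_le _ _
  exact absurd h1 (not_le.2 (Nat.pow_lt_pow_right Fintype.one_lt_card hlt))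

end Kernel

end Ore

end

/-! ### Torsion, isogenies and their codomains, Frobenius, associated ideals. -/

section

variable {Fq L : Type*} [Field Fq] [Fintype Fq] [Field L] [Algebra Fq L]

/-- A finite `Fq[X]`-module killed by an irreducible `r` is a vector space over `Fq[X] / (r)`;
if it is a line, its endomorphisms are scalars. -/
theorem natCard_eq_of_irreducible {W : Type*} [AddCommGroup W] [Finite W]
    (ρ : Fq[X] →+* AddMonoid.End W) {r : Fq[X]} (hr : Irreducible r) (hρ : ρ r = 0)
    (T : AddMonoid.End W) (hT : ∀ a w, T (ρ a w) = ρ a (T w)) :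
    ∃ n, Nat.card W = Fintype.card Fq ^ (r.natDegree * n) ∧
      (n = 1 → ∃ v, ∀ w, T w = ρ v w) := by
  have : Fact (Irreducible r) := ⟨hr⟩
  let ρ' : AdjoinRoot r →+* AddMonoid.End W :=
    Ideal.Quotient.lift (Ideal.span {r}) ρ (by
      intro a ha
      obtain ⟨b, rfl⟩ := Ideal.mem_span_singleton'.1 ha
      rw [map_mul, hρ, mul_zero])
  have hρ' : ∀ a, ρ' (AdjoinRoot.mk r a) = ρ a := fun a => Ideal.Quotient.lift_mk _ _ _
  let _ : Module (AdjoinRoot r) W := Module.compHom W ρ'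
  have hsmul : ∀ a w, AdjoinRoot.mk r a • w = ρ a w := fun a w => by
    rw [← hρ']
    rfl
  have hfin : Module.Finite Fq (AdjoinRoot r) :=
    (AdjoinRoot.powerBasis hr.ne_zero).finite
  have hcard : Nat.card (AdjoinRoot r) = Fintype.card Fq ^ r.natDegree := by
    rw [Module.natCard_eq_pow_finrank (K := Fq), (AdjoinRoot.powerBasis hr.ne_zero).finrank,
      AdjoinRoot.powerBasis_dim, Nat.card_eq_fintype_card]
  refine ⟨Module.finrank (AdjoinRoot r) W, ?_, fun h1 => ?_⟩
  · rw [Module.natCard_eq_pow_finrank (K := AdjoinRoot r), hcard, pow_mul]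
  · obtain ⟨w₀, -, hw₀⟩ := finrank_eq_one_iff'.1 h1
    obtain ⟨c, hc⟩ := hw₀ (T w₀)
    obtain ⟨v, rfl⟩ := AdjoinRoot.mk_surjective c
    refine ⟨v, fun w => ?_⟩
    obtain ⟨a, rfl⟩ := hw₀ w
    obtain ⟨a, rfl⟩ := AdjoinRoot.mk_surjective a
    rw [hsmul, hT, ← hc, hsmul]
    change (ρ a * ρ v) w₀ = (ρ v * ρ a) w₀
    rw [← map_mul, mul_comm, map_mul]

/-- Restriction of additive endomorphisms to a stable subgroup. -/
def restrictEnd {K R : Type*} [AddCommGroup K] [Ring R] (ρ : R →+* AddMonoid.End K)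
    (W : AddSubgroup K) (h : ∀ a, ∀ w ∈ W, ρ a w ∈ W) : R →+* AddMonoid.End W where
  toFun a := AddMonoidHom.mk' (fun w : W => (⟨ρ a w, h a w w.2⟩ : W)) fun x y =>
    Subtype.ext (map_add (ρ a) (x : K) y)
  map_one' := by
    ext w
    change ρ 1 (w : K) = w
    rw [map_one]
    rfl
  map_mul' a b := by
    ext w
    change ρ (a * b) (w : K) = ρ a (ρ b w)
    rw [map_mul]
    rfl
  map_zero' := by
    ext w
    change ρ 0 (w : K) = 0
    rw [map_zero]
    rfl
  map_add' a b := by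
    ext w
    change ρ (a + b) (w : K) = ρ a w + ρ b w
    rw [map_add]
    rfl

namespace DrinfeldModule

variable {γ : Fq[X] →ₐ[Fq] L}

theorem HasRank.toHom_ne_zero {φ : DrinfeldModule γ} (hφ : φ.HasRank 2) {a : Fq[X]}
    (ha : a ≠ 0) : φ.toHom a ≠ 0 := by
  intro h
  have h1 := hφ (a * X)
  rw [map_mul, h, zero_mul, natDegree_mul_X ha] at h1
  change 0 = _ at h1
  omega

theorem commute_toHom (φ : DrinfeldModule γ) (a b : Fq[X]) :
    φ.toHom a * φ.toHom b = φ.toHom b * φ.toHom a := by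
  rw [← map_mul, mul_comm, map_mul]

theorem toHom_injective : Function.Injective (toHom : DrinfeldModule γ → _) := by
  rintro ⟨f, _, _⟩ ⟨g, _, _⟩ h
  cases h
  rfl

theorem IsIsogeny.tdeg_eq {φ ψ : DrinfeldModule γ} {κ : Ore Fq L} (h : φ.IsIsogeny ψ κ)
    (a : Fq[X]) : (ψ.toHom a).tdeg = (φ.toHom a).tdeg := by
  have h0 := h.1
  have e := h.2 a
  by_cases h1 : φ.toHom a = 0
  · rw [h1, mul_zero, eq_comm, mul_eq_zero, or_iff_left h0] at e
    rw [e, h1]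
  · have h2 : ψ.toHom a ≠ 0 := left_ne_zero_of_mul (e ▸ mul_ne_zero h0 h1)
    have := congrArg Ore.tdeg e
    rw [Ore.tdeg_mul h0 h1, Ore.tdeg_mul h2 h0] at this
    omega

theorem IsIsogeny.of_mul {φ χ ψ : DrinfeldModule γ} {κ η : Ore Fq L} (hκ : φ.IsIsogeny χ κ)
    (h : φ.IsIsogeny ψ (η * κ)) : χ.IsIsogeny ψ η := by
  refine ⟨left_ne_zero_of_mul h.1, fun a => mul_right_cancel₀ hκ.1 ?_⟩
  rw [mul_assoc, ← hκ.2 a, ← mul_assoc, h.2 a, mul_assoc]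

/-- A separable Ore polynomial that generates a left ideal stable under `φ` on the right is an
isogeny from `φ`. -/
theorem exists_isIsogeny (φ : DrinfeldModule γ) {κ : Ore Fq L} (hκ : κ.IsSeparable)
    (h : ∀ a, κ.RightDvd (κ * φ.toHom a)) : ∃ φ', φ.IsIsogeny φ' κ := by
  -- The quotients are unique because `L{τ}` is a domain, so cancelling `κ` shows that they form an
  -- algebra morphism.
  choose W hW using h
  have h0 := hκ.ne_zero
  let f : Fq[X] →ₐ[Fq] Ore Fq L :=
    { toFun := W
      map_one' := mul_right_cancel₀ h0 (by rw [← hW, map_one, mul_one, one_mul])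
      map_mul' := fun a b => mul_right_cancel₀ h0 (by
        rw [← hW, map_mul, ← mul_assoc, hW, mul_assoc, hW, mul_assoc])
      map_zero' := mul_right_cancel₀ h0 (by rw [← hW, map_zero, mul_zero, zero_mul])
      map_add' := fun a b => mul_right_cancel₀ h0 (by
        rw [← hW, map_add, mul_add, hW, hW, add_mul])
      commutes' := fun c => mul_right_cancel₀ h0 (by
        rw [← hW, AlgHom.commutes, Algebra.commutes]) }
  have hf : ∀ a, κ * φ.toHom a = f a * κ := hW
  refine ⟨⟨f, fun a => ?_, ?_⟩, h0, hf⟩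
  · have := congrArg (fun P => P.coeff 0) (hf a)
    simp only [Ore.coeff_mul_zero, φ.coeff_zero] at this
    rw [mul_comm] at this
    exact (mul_right_cancel₀ hκ this).symm
  · obtain ⟨a, ha⟩ := φ.exists_tdeg_pos
    refine ⟨a, ?_⟩
    have h1 : φ.toHom a ≠ 0 := by
      rintro h
      rw [h] at ha
      exact lt_irrefl 0 ha
    have h2 : f a ≠ 0 := left_ne_zero_of_mul ((hf a) ▸ mul_ne_zero h0 h1)
    have := congrArg Ore.tdeg (hf a)
    rw [Ore.tdeg_mul h0 h1, Ore.tdeg_mul h2 h0] at this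
    omega

/-- Compare the coefficients of `τ^i` in `κ φ_X = φ'_X κ` and isolate the term `j = i` on the right.
-/
theorem coeff_codomain {φ φ' : DrinfeldModule γ} {κ : Ore Fq L} (hκ : κ.IsSeparable)
    (h : φ.IsMorphism φ' κ) (i : ℕ) :
    (φ'.toHom X).coeff i =
      (κ.coeff 0 ^ (Fintype.card Fq ^ i))⁻¹ *
        (∑ j ∈ Finset.range (i + 1),
            κ.coeff j * (φ.toHom X).coeff (i - j) ^ (Fintype.card Fq ^ j)
          - ∑ j ∈ Finset.range i,
            (φ'.toHom X).coeff j * κ.coeff (i - j) ^ (Fintype.card Fq ^ j)) := by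
  have := congrArg (fun P => P.coeff i) (h X)
  simp only [Ore.coeff_mul] at this
  rw [this, Finset.sum_range_succ, Nat.sub_self, add_sub_cancel_left, mul_comm,
    mul_assoc, mul_inv_cancel₀ (pow_ne_zero _ hκ), mul_one]

theorem IsIsogeny.isVeluCodomain {φ φ' : DrinfeldModule γ} {κ : Ore Fq L} (hκ : κ.IsSeparable)
    (h : φ.IsIsogeny φ' κ) : φ.IsVeluCodomain κ φ' :=
  ⟨(h.tdeg_eq X).le, fun i _ => coeff_codomain hκ h.2 i⟩

/-- This identifies the module computed by the algorithm with the true codomain of the isogeny. -/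
theorem IsVeluCodomain.unique {φ φ₁ φ₂ : DrinfeldModule γ} {κ : Ore Fq L}
    (h₁ : φ.IsVeluCodomain κ φ₁) (h₂ : φ.IsVeluCodomain κ φ₂) : φ₁ = φ₂ := by
  refine toHom_injective (Polynomial.algHom_ext (Ore.ext fun n => ?_))
  induction n using Nat.strong_induction_on with
  | _ n ih =>
    by_cases hn : n ≤ (φ.toHom X).tdeg
    · rw [h₁.2 n hn, h₂.2 n hn]
      congr 2
      exact Finset.sum_congr rfl fun j hj => by rw [ih j (Finset.mem_range.1 hj)]
    · have := h₁.1
      have := h₂.1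
      rw [Ore.coeff_eq_zero_of_tdeg_lt (by omega), Ore.coeff_eq_zero_of_tdeg_lt (by omega)]

section Frobenius

variable [FiniteDimensional Fq L]

/-- The kernel of `κ` is a vector space of some dimension `n` over `Fq[X]/(r)`, and it has `q^(deg
κ)` elements. `τ_L` acts on it linearly; if `n = 1` it acts as some `v`, so `τ_L - φ_v` vanishes on
the kernel and `κ` right-divides it. -/
theorem exists_tdeg_eq_natDegree_mul (φ : DrinfeldModule γ) {κ : Ore Fq L} (hκ : κ.IsSeparable)
    (hst : ∀ a, κ.RightDvd (κ * φ.toHom a)) {r : Fq[X]} (hr : Irreducible r)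
    (hdvd : κ.RightDvd (φ.toHom r)) :
    ∃ n, κ.tdeg = r.natDegree * n ∧
      (n = 1 → ∃ v, κ.RightDvd (Ore.tauL Fq L - φ.toHom v)) := by
  let K := AlgebraicClosure L
  have := Ore.finite_ker K hκ.ne_zero
  let ρ := restrictEnd ((Ore.act K).comp (φ.toHom : Fq[X] →+* Ore Fq L)) (κ.ker K) (by
    intro a w hw
    obtain ⟨W, hW⟩ := hst a
    rw [Ore.mem_ker] at *
    change Ore.act K κ (Ore.act K (φ.toHom a) w) = 0
    rw [← Ore.act_mul, hW, Ore.act_mul, hw, map_zero])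
  have hρ : ∀ a w, (ρ a w : K) = Ore.act K (φ.toHom a) w := fun _ _ => rfl
  let T : AddMonoid.End (κ.ker K) :=
    AddMonoidHom.mk' (fun w => ⟨Ore.act K (Ore.tauL Fq L) w, by
      rw [Ore.mem_ker, ← Ore.act_mul, (Ore.commute_tauL κ).eq, Ore.act_mul,
        (Ore.mem_ker K).1 w.2, map_zero]⟩) fun x y =>
      Subtype.ext (map_add (Ore.act K (Ore.tauL Fq L)) (x : K) y)
  have hT : ∀ w, (T w : K) = Ore.act K (Ore.tauL Fq L) w := fun _ => rfl
  obtain ⟨n, hn, hv⟩ := natCard_eq_of_irreducible ρ hr (by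
      ext w
      rw [hρ]
      exact (Ore.mem_ker K).1 (hdvd.ker_le K w.2)) T (fun a w => Subtype.ext (by
      rw [hT, hρ, hρ, hT, ← Ore.act_mul, ← Ore.act_mul, (Ore.commute_tauL _).eq]))
  rw [Ore.natCard_ker K hκ] at hn
  refine ⟨n, Nat.pow_right_injective Fintype.one_lt_card hn, fun h1 => ?_⟩
  obtain ⟨v, hv⟩ := hv h1
  refine ⟨v, Ore.rightDvd_of_ker_le K hκ fun w hw => ?_⟩
  rw [Ore.mem_ker, Ore.act_sub, sub_eq_zero]
  exact congrArg Subtype.val (hv ⟨w, hw⟩)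

theorem evalXY_C (φ : DrinfeldModule γ) (a : Fq[X]) : φ.evalXY (C a) = φ.toHom a :=
  eval₂_C _ _

theorem evalXY_X (φ : DrinfeldModule γ) : φ.evalXY X = Ore.tauL Fq L :=
  eval₂_X _ _

theorem IsMorphism.mul_evalXY {φ ψ : DrinfeldModule γ} {κ : Ore Fq L} (h : φ.IsMorphism ψ κ)
    (g : Fq[X][X]) : κ * φ.evalXY g = ψ.evalXY g * κ := by
  induction g using Polynomial.induction_on' with
  | add g g' hg hg' => rw [map_add, map_add, mul_add, hg, hg', add_mul]
  | monomial n a =>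
    have hc : Commute κ (Ore.tauL Fq L ^ n) := (Ore.commute_tauL κ).pow_right n
    rw [← C_mul_X_pow_eq_monomial, map_mul, map_mul, map_pow, map_pow, evalXY_C, evalXY_C,
      evalXY_X, evalXY_X, ← mul_assoc, h a, mul_assoc, hc.eq, mul_assoc]

variable {h f : Fq[X]}

theorem IsIsogeny.memDr2 {φ ψ : DrinfeldModule γ} {κ : Ore Fq L} (hκ : φ.IsIsogeny ψ κ)
    (hφ : φ.MemDr2 h f) : ψ.MemDr2 h f where
  rank_two a := by rw [hκ.tdeg_eq, hφ.rank_two a]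
  charPoly :=
    { hφ.charPoly with
      eval_eq_zero := mul_right_cancel₀ hκ.1 (by
        rw [← hκ.2.mul_evalXY, hφ.charPoly.eval_eq_zero, mul_zero, zero_mul]) }

theorem evalA_mk (φ : DrinfeldModule γ) (hφ : φ.MemDr2 h f) (g : Fq[X][X]) :
    φ.evalA hφ (AdjoinRoot.mk (xi h f) g) = φ.evalXY g :=
  Ideal.Quotient.lift_mk _ _ _

@[simp] theorem evalA_of (φ : DrinfeldModule γ) (hφ : φ.MemDr2 h f) (a : Fq[X]) :
    φ.evalA hφ (AdjoinRoot.of (xi h f) a) = φ.toHom a :=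
  (φ.evalA_mk hφ _).trans (φ.evalXY_C a)

@[simp] theorem evalA_root (φ : DrinfeldModule γ) (hφ : φ.MemDr2 h f) :
    φ.evalA hφ (AdjoinRoot.root (xi h f)) = Ore.tauL Fq L :=
  (φ.evalA_mk hφ _).trans φ.evalXY_X

theorem IsMorphism.mul_evalA {φ ψ : DrinfeldModule γ} {κ : Ore Fq L} (hκ : φ.IsMorphism ψ κ)
    (hφ : φ.MemDr2 h f) (hψ : ψ.MemDr2 h f) (g : CoordRing h f) :
    κ * φ.evalA hφ g = ψ.evalA hψ g * κ := by
  obtain ⟨g, rfl⟩ := AdjoinRoot.mk_surjective g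
  rw [evalA_mk, evalA_mk, hκ.mul_evalXY]

/-- A left cofactor of `ι` in an endomorphism of `φ` is automatically a morphism `ψ → φ`, as one
sees by cancelling `ι`. -/
theorem mem_assocIdeal {φ ψ : DrinfeldModule γ} (hφ : φ.MemDr2 h f) {ι : Ore Fq L}
    (hι : φ.IsIsogeny ψ ι) {g : CoordRing h f} :
    g ∈ φ.assocIdeal ψ hφ ι ↔ ι.RightDvd (φ.evalA hφ g) := by
  constructor
  · rintro ⟨η, -, hη⟩
    exact ⟨η, hη⟩
  · rintro ⟨η, hη⟩
    refine ⟨η, fun a => mul_right_cancel₀ hι.1 ?_, hη⟩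
    rw [mul_assoc, ← hι.2 a, ← mul_assoc, ← hη, φ.evalA_mem_End hφ g a, hη, mul_assoc]

theorem xi_monic (h f : Fq[X]) : (xi h f).Monic := by
  unfold xi
  monicity!

theorem natDegree_xi (h f : Fq[X]) : (xi h f).natDegree = 2 := by
  unfold xi
  compute_degree!

theorem exists_eq_of_add_of_mul_root (g : CoordRing h f) :
    ∃ a b, g = AdjoinRoot.of (xi h f) a + AdjoinRoot.of (xi h f) b * AdjoinRoot.root (xi h f) := by
  obtain ⟨g, rfl⟩ := AdjoinRoot.mk_surjective g
  have hm := xi_monic h f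
  have hd : (g %ₘ xi h f).natDegree ≤ 1 := by
    have := natDegree_modByMonic_lt g hm (fun h1 => by
      have := natDegree_xi h f
      rw [h1, natDegree_one] at this
      omega)
    rw [natDegree_xi] at this
    omega
  obtain ⟨b, a, hab⟩ := exists_eq_X_add_C_of_natDegree_le_one hd
  refine ⟨a, b, ?_⟩
  rw [← modByMonic_add_div g (xi h f), hab, map_add, map_add, map_mul, map_mul, AdjoinRoot.mk_self,
    zero_mul, add_zero, AdjoinRoot.mk_X, AdjoinRoot.mk_C, AdjoinRoot.mk_C, add_comm]

/-- The relation `Y² + h Y = f` in the coordinate ring. -/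
theorem root_sq (h f : Fq[X]) :
    AdjoinRoot.root (xi h f) ^ 2 + AdjoinRoot.of (xi h f) h * AdjoinRoot.root (xi h f) =
      AdjoinRoot.of (xi h f) f := by
  have := AdjoinRoot.mk_self (f := xi h f)
  unfold xi at this ⊢
  rw [map_sub, map_add, map_pow, map_mul, sub_eq_zero] at this
  exact this

theorem MemDr2.tauL_sq {φ : DrinfeldModule γ} (hφ : φ.MemDr2 h f) :
    Ore.tauL Fq L ^ 2 + φ.toHom h * Ore.tauL Fq L = φ.toHom f := by
  have := congrArg (φ.evalA hφ) (root_sq h f)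
  simpa using this

end Frobenius

end DrinfeldModule

end

/-! ### Smoothness and the maximality of `Fq[X][τ_L]` at each prime. -/

section

variable {Fq L : Type*} [Field Fq] [Fintype Fq] [Field L] [Algebra Fq L]

/-- If both divisibilities held, then at a root `x` of `r` the point `(x, v(x))` would lie on the
curve with vanishing `Y`-derivative. Differentiating `ξ(X, v(X))`, a multiple of `r²`, would then
kill the `X`-derivative as well. -/
theorem IsSmoothAffine.not_sq_dvd {h f : Fq[X]} (hs : IsSmoothAffine h f) {r : Fq[X]}
    (hr : Irreducible r) (v : Fq[X]) (h1 : r ∣ 2 * v + h) : ¬ r ^ 2 ∣ v ^ 2 + h * v - f := by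
  rintro ⟨k, hk⟩
  obtain ⟨c, hc⟩ := h1
  obtain ⟨x, hx⟩ := IsAlgClosed.exists_aeval_eq_zero (AlgebraicClosure Fq) r
    (degree_pos_of_irreducible hr).ne'
  have e1 := congrArg (aeval x) hk
  have e2 := congrArg (aeval x) hc
  have e3 := congrArg (fun P => aeval x (derivative P)) hk
  simp only [map_add, map_sub, map_mul, map_pow, derivative_mul, derivative_pow, map_ofNat, hx] at e1 e2 e3
  refine hs x (aeval x v) (by linear_combination e1) ⟨by linear_combination e2, ?_⟩
  norm_num at e3
  rw [map_ofNat] at e3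
  linear_combination e3 - aeval x (derivative v) * e2

theorem Irreducible.exists_mul_add_mul_eq_one {r c : Fq[X]} (hr : Irreducible r) (hc : ¬ r ∣ c) :
    ∃ a b, a * c + b * r = 1 := by
  obtain ⟨a, b, hab⟩ := (hr.coprime_iff_not_dvd.2 hc)
  exact ⟨b, a, by rw [← hab, add_comm]⟩

namespace DrinfeldModule

variable {γ : Fq[X] →ₐ[Fq] L} {φ : DrinfeldModule γ}

theorem rightDvd_toHom_of_dvd (φ : DrinfeldModule γ) {a b : Fq[X]} (h : a ∣ b) :
    (φ.toHom a).RightDvd (φ.toHom b) := by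
  obtain ⟨c, rfl⟩ := h
  exact ⟨φ.toHom c, by rw [mul_comm, map_mul]⟩

theorem HasRank.dvd_of_rightDvd (hφ : φ.HasRank 2) {a b : Fq[X]} (ha : a ≠ 0)
    (h : (φ.toHom a).RightDvd (φ.toHom b)) : a ∣ b := by
  have h1 : (φ.toHom a).RightDvd (φ.toHom (b % a)) := by
    have := h.sub (φ.rightDvd_toHom_of_dvd (dvd_mul_right a (b / a)))
    rwa [← map_sub, ← EuclideanDomain.mod_eq_sub_mul_div] at this
  rw [← EuclideanDomain.mod_eq_zero]
  by_contra h0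
  have h2 := h1.tdeg_le (hφ.toHom_ne_zero h0)
  rw [hφ, hφ] at h2
  have h3 : natDegree (b % a) < natDegree a := by
    refine natDegree_lt_natDegree h0 (EuclideanDomain.mod_lt b ha)
  omega

theorem exists_ringHom_of_commute (φ : DrinfeldModule γ) {θ : Ore Fq L}
    (hθ : ∀ a, Commute (φ.toHom a) θ) :
    ∃ E : Fq[X][X] →+* Ore Fq L, (∀ a, E (C a) = φ.toHom a) ∧ E X = θ :=
  ⟨eval₂RingHom' (φ.toHom : Fq[X] →+* Ore Fq L) θ hθ, fun _ => eval₂_C _ _, eval₂_X _ _⟩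

variable [FiniteDimensional Fq L] {h f : Fq[X]}

theorem MemDr2.tdeg_tauL_sub_lt (hφ : φ.MemDr2 h f) {v : Fq[X]} {n : ℕ}
    (hn : Module.finrank Fq L < n) (hv : 2 * v.natDegree < n)
    (h0 : Ore.tauL Fq L - φ.toHom v ≠ 0) : (Ore.tauL Fq L - φ.toHom v).tdeg < n := by
  refine Ore.tdeg_lt h0 fun k hk => ?_
  rw [Ore.coeff_sub, Ore.coeff_eq_zero_of_tdeg_lt, Ore.coeff_eq_zero_of_tdeg_lt, sub_zero]
  · rw [hφ.rank_two]
    omega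
  · rw [Ore.tauL, Ore.tdeg_tau_pow]
    omega

theorem MemDr2.tauL_ne_toHom (hφ : φ.MemDr2 h f) (hodd : Odd (Module.finrank Fq L))
    (v : Fq[X]) : Ore.tauL Fq L ≠ φ.toHom v := by
  intro e
  have := congrArg Ore.tdeg e
  rw [hφ.rank_two, Ore.tauL, Ore.tdeg_tau_pow] at this
  exact Nat.not_odd_iff_even.2 (this ▸ even_two_mul _) hodd

/-- If `τ_L = φ_v + θ φ_s`, then `θ` satisfies a quadratic equation over `Fq[X]`. -/
theorem MemDr2.exists_evaluation (hφ : φ.MemDr2 h f) {s v : Fq[X]} (hs : s ≠ 0)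
    (hd : (φ.toHom s).RightDvd (Ore.tauL Fq L - φ.toHom v)) :
    ∃ E : Fq[X][X] →+* Ore Fq L, (∀ a, E (C a) = φ.toHom a) ∧
      Ore.tauL Fq L = E (C v + X * C s) ∧
      E (X ^ 2 * C (s ^ 2) + X * C ((2 * v + h) * s)) = - φ.toHom (v ^ 2 + h * v - f) := by
  obtain ⟨θ, hθ⟩ := hd
  have hs0 := hφ.rank_two.toHom_ne_zero hs
  have hcomm : ∀ a, Commute (φ.toHom a) θ := by
    intro a
    rw [commute_iff_eq]
    refine mul_right_cancel₀ hs0 ?_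
    rw [mul_assoc, mul_assoc, ← hθ, φ.commute_toHom a s, ← mul_assoc, ← hθ, mul_sub, sub_mul,
      φ.commute_toHom, (Ore.commute_tauL _).eq]
  obtain ⟨E, hE, hEX⟩ := φ.exists_ringHom_of_commute hcomm
  have hτ : Ore.tauL Fq L = E (C v + X * C s) := by
    rw [map_add, map_mul, hE, hE, hEX, ← hθ, add_sub_cancel]
  refine ⟨E, hE, hτ, ?_⟩
  -- Substitute `Y = v + θ s` in `ξ`; expanding gives the quadratic equation of `θ`.
  have hz : E ((C v + X * C s) ^ 2 + C h * (C v + X * C s) - C f) = 0 := by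
    rw [map_sub, map_add E (_ ^ 2), map_mul E (C h), map_pow, ← hτ, hE, hE, hφ.tauL_sq, sub_self]
  rw [← hE, eq_neg_iff_add_eq_zero, ← map_add, ← hz]
  refine congrArg E ?_
  simp only [map_add, map_mul, map_pow, map_sub, map_ofNat]
  ring

/-- In the separable case of Hensel lifting, `τ_L` would be congruent to an element of `Fq[X]`
modulo every power of `r`. -/
theorem MemDr2.exists_rightDvd_pow (hφ : φ.MemDr2 h f) {r : Fq[X]} (hr : Irreducible r)
    {v : Fq[X]} (hv : ¬ r ∣ 2 * v + h)
    (hd : (φ.toHom r).RightDvd (Ore.tauL Fq L - φ.toHom v)) (n : ℕ) :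
    ∃ w, ¬ r ∣ 2 * w + h ∧
      (φ.toHom (r ^ (n + 1))).RightDvd (Ore.tauL Fq L - φ.toHom w) := by
  induction n with
  | zero => exact ⟨v, hv, by simpa using hd⟩
  | succ n ih =>
    obtain ⟨w, hw, hdw⟩ := ih
    have hr0 := hr.ne_zero
    obtain ⟨E, hE, hτ, hq⟩ := hφ.exists_evaluation (pow_ne_zero (n + 1) hr0) hdw
    obtain ⟨N, hN⟩ : r ^ (n + 1) ∣ w ^ 2 + h * w - f := by
      refine hφ.rank_two.dvd_of_rightDvd (pow_ne_zero (n + 1) hr0)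
        ⟨-E (X ^ 2 * C (r ^ (n + 1)) + X * C (2 * w + h)), ?_⟩
      rw [← neg_eq_iff_eq_neg.2 hq, ← hE (r ^ (n + 1)), neg_mul, ← map_mul]
      refine congrArg (fun P => -E P) ?_
      simp only [map_add, map_mul, map_pow, map_ofNat]
      ring
    -- `a` inverts the derivative `2w + h` of `ξ` at `w` modulo `r`.
    obtain ⟨a, b, hab⟩ := hr.exists_mul_add_mul_eq_one hw
    have hq' : E (X ^ 2 * C (r ^ (n + 1)) + X * C (2 * w + h) + C N) = 0 := by
      refine (mul_eq_zero.1 ?_).resolve_right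
        (hφ.rank_two.toHom_ne_zero (pow_ne_zero (n + 1) hr0))
      rw [eq_neg_iff_add_eq_zero, hN, ← hE, ← map_add] at hq
      rw [← hE, ← map_mul, ← hq]
      refine congrArg E ?_
      simp only [map_add, map_mul, map_pow, map_ofNat]
      ring
    -- Newton step: from `θ² r^(n+1) + θ (2w + h) + N = 0` and `a (2w + h) + b r = 1` one gets `θ +
    -- a N = (b θ - a θ² r^n) r`.
    refine ⟨w - a * N * r ^ (n + 1), ?_, E (C b * X - C a * X ^ 2 * C (r ^ n)), ?_⟩
    · intro h1
      refine hw ((dvd_add_right (b := -(2 * (a * N * r ^ n)) * r) (dvd_mul_left _ _)).1 ?_)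
      convert h1 using 1
      ring
    · rw [hτ, ← hE, ← map_sub, ← hE, ← map_mul, ← sub_eq_zero, ← map_sub]
      have e : C w + X * C (r ^ (n + 1)) - C (w - a * N * r ^ (n + 1)) -
          (C b * X - C a * X ^ 2 * C (r ^ n)) * C (r ^ (n + 1 + 1)) =
          C (a * r ^ (n + 1)) * (X ^ 2 * C (r ^ (n + 1)) + X * C (2 * w + h) + C N) +
            X * C (r ^ (n + 1)) * C (1 - (a * (2 * w + h) + b * r)) := by
        simp only [map_add, map_mul, map_pow, map_sub, map_ofNat, map_one]
        ring
      rw [e, hab, sub_self, map_zero, mul_zero, add_zero, map_mul, hq', mul_zero]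

/-- `Fq[X][τ_L]` is maximal at every prime: smoothness forbids `(τ_L - φ_v) / φ_r`. -/
theorem MemDr2.not_rightDvd_tauL_sub (hφ : φ.MemDr2 h f) (hodd : Odd (Module.finrank Fq L))
    (hs : IsSmoothAffine h f) {r : Fq[X]} (hr : Irreducible r) (v : Fq[X]) :
    ¬ (φ.toHom r).RightDvd (Ore.tauL Fq L - φ.toHom v) := by
  intro hd
  by_cases hc : r ∣ 2 * v + h
  · refine hs.not_sq_dvd hr v hc (hφ.rank_two.dvd_of_rightDvd (pow_ne_zero 2 hr.ne_zero) ?_)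
    obtain ⟨E, hE, -, hq⟩ := hφ.exists_evaluation hr.ne_zero hd
    obtain ⟨k, hk⟩ := hc
    refine ⟨-E (X ^ 2 + X * C k), ?_⟩
    rw [hk] at hq
    rw [← neg_eq_iff_eq_neg.2 hq, ← hE (r ^ 2), neg_mul, ← map_mul]
    refine congrArg (fun P => -E P) ?_
    simp only [map_mul, map_pow]
    ring
  · obtain ⟨w, -, hw⟩ := hφ.exists_rightDvd_pow hr hc hd (Module.finrank Fq L)
    set s := r ^ (Module.finrank Fq L + 1) with hsdef
    have hs0 : s ≠ 0 := pow_ne_zero _ hr.ne_zero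
    have hrd := hr.natDegree_pos
    have hsd : Module.finrank Fq L + 1 ≤ s.natDegree := by
      rw [hsdef, natDegree_pow]
      exact Nat.le_mul_of_pos_right _ hrd
    have hw' : (φ.toHom s).RightDvd (Ore.tauL Fq L - φ.toHom (w % s)) := by
      have := hw.add (φ.rightDvd_toHom_of_dvd (dvd_mul_right s (w / s)))
      rwa [sub_add, ← map_sub, ← EuclideanDomain.mod_eq_sub_mul_div] at this
    have h0 : Ore.tauL Fq L - φ.toHom (w % s) ≠ 0 :=
      sub_ne_zero.2 (hφ.tauL_ne_toHom hodd _)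
    have h1 := hw'.tdeg_le h0
    rw [hφ.rank_two] at h1
    have h2 : (w % s).natDegree < s.natDegree :=
      natDegree_mod_lt _ (by omega)
    exact absurd h1 (not_le.2 (hφ.tdeg_tauL_sub_lt (by omega) (by omega) h0))

end DrinfeldModule

end

/-! ### One step of the recursion: the right-gcd with `φ_r` and the ideal of a composition. -/

section

variable {Fq L : Type*} [Field Fq] [Fintype Fq] [Field L] [Algebra Fq L]

theorem Ore.IsRightRem.rightDvd_sub {P Q R : Ore Fq L} (h : P.IsRightRem Q R) :
    Q.RightDvd (P - R) := by
  obtain ⟨⟨W, hW⟩, -⟩ := h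
  exact ⟨W, by rw [hW, add_sub_cancel_right]⟩

theorem Ore.IsRgcd.eq_one_of_tdeg_eq_zero {S : Set (Ore Fq L)} {g : Ore Fq L}
    (h : Ore.IsRgcd S g) (hd : g.tdeg = 0) : g = 1 := by
  have h1 := h.1
  rw [Ore.IsMonic, hd] at h1
  rw [Ore.eq_C_of_tdeg_eq_zero hd, h1, map_one]

namespace DrinfeldModule

variable {γ : Fq[X] →ₐ[Fq] L} {φ φ' ψ : DrinfeldModule γ}

theorem HasRank.isIsogeny_toHom (hφ : φ.HasRank 2) {a : Fq[X]} (ha : a ≠ 0) :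
    φ.IsIsogeny φ (φ.toHom a) :=
  ⟨hφ.toHom_ne_zero ha, fun b => φ.commute_toHom a b⟩

/-- Writing `κ = A ι + B φ_r` gives `κ φ_a = A ψ_a ι + B φ_a φ_r`. This stability is what makes `κ`
an isogeny. -/
theorem rightDvd_mul_toHom_of_isRgcd {ι κ : Ore Fq L} {r : Fq[X]}
    (hg : Ore.IsRgcd {ι, φ.toHom r} κ) (hι : φ.IsIsogeny ψ ι) (a : Fq[X]) :
    κ.RightDvd (κ * φ.toHom a) := by
  obtain ⟨A, B, e⟩ := hg.exists_eq
  have h1 : κ.RightDvd ι := hg.rightDvd (by simp)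
  have h2 : κ.RightDvd (φ.toHom r) := hg.rightDvd (by simp)
  have h3 := (h1.mul_left (A * ψ.toHom a)).add (h2.mul_left (B * φ.toHom a))
  rwa [mul_assoc, ← hι.2 a, mul_assoc B, φ.commute_toHom a r, ← mul_assoc, ← mul_assoc,
    ← add_mul, ← e] at h3

/-- The passage from `u` to `u / r`: by Bézout `κ φ_w = A ψ_w ι + B φ_(rw)`. After cancelling `κ`,
the quotient `η` right-divides `φ'_w`; for `κ = 1` this removes the factor `r` altogether. -/
theorem rightDvd_mul_toHom_of_mul {ι κ : Ore Fq L} {r w : Fq[X]}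
    (hg : Ore.IsRgcd {ι, φ.toHom r} κ) (hι : φ.IsIsogeny ψ ι)
    (hw : ι.RightDvd (φ.toHom (r * w))) : ι.RightDvd (κ * φ.toHom w) := by
  obtain ⟨A, B, e⟩ := hg.exists_eq
  rw [e, add_mul, mul_assoc, hι.2 w, mul_assoc, ← map_mul]
  exact Ore.RightDvd.add ⟨A * ψ.toHom w, by rw [mul_assoc]⟩ (hw.mul_left B)

theorem rightDvd_toHom_of_pow_mul {ι : Ore Fq L} {r w : Fq[X]}
    (hg : Ore.IsRgcd {ι, φ.toHom r} 1) (hι : φ.IsIsogeny ψ ι) (k : ℕ)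
    (hw : ι.RightDvd (φ.toHom (r ^ k * w))) : ι.RightDvd (φ.toHom w) := by
  induction k with
  | zero => simpa using hw
  | succ k ih =>
    refine ih ?_
    rw [pow_succ', mul_assoc] at hw
    simpa using rightDvd_mul_toHom_of_mul hg hι hw

/-- If `r` and `a` were coprime, a Bézout relation would make `κ` right-divide 1. -/
theorem dvd_of_rightDvd_toHom (φ : DrinfeldModule γ) {κ : Ore Fq L} {r a : Fq[X]}
    (hr : Irreducible r) (hκ : κ.tdeg ≠ 0)
    (hκr : κ.RightDvd (φ.toHom r)) (ha : κ.RightDvd (φ.toHom a)) : r ∣ a := by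
  by_contra h
  obtain ⟨x, y, hxy⟩ := hr.exists_mul_add_mul_eq_one h
  have h1 := (ha.mul_left (φ.toHom x)).add (hκr.mul_left (φ.toHom y))
  rw [← map_mul, ← map_mul, ← map_add, hxy, map_one] at h1
  have h2 := h1.tdeg_le one_ne_zero
  rw [← map_one Ore.C, Ore.tdeg_C] at h2
  omega

variable [FiniteDimensional Fq L] {h f : Fq[X]}

/-- A proper nonzero subgroup of the `r`-torsion is a line over `Fq[X] / (r)`, on which the
Frobenius acts as a scalar. -/
theorem MemDr2.tdeg_eq_and_exists (hφ : φ.MemDr2 h f) {κ : Ore Fq L} (hκ : κ.IsSeparable)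
    (hst : ∀ a, κ.RightDvd (κ * φ.toHom a)) {r : Fq[X]} (hr : Irreducible r)
    (hκr : κ.RightDvd (φ.toHom r)) (h0 : κ.tdeg ≠ 0)
    (hne : ¬ ∃ c : L, c ≠ 0 ∧ κ = Ore.C c * φ.toHom r) :
    κ.tdeg = r.natDegree ∧ ∃ v, κ.RightDvd (Ore.tauL Fq L - φ.toHom v) := by
  obtain ⟨n, hn, hv⟩ := φ.exists_tdeg_eq_natDegree_mul hκ hst hr hκr
  have hr0 := hφ.rank_two.toHom_ne_zero hr.ne_zero
  have hle := hκr.tdeg_le hr0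
  rw [hφ.rank_two, hn, mul_comm 2] at hle
  -- The `r`-torsion has dimension at most 2; dimension 0 is excluded by the degree, and dimension 2
  -- would give all of `φ_r`.
  have hn2 : n ≤ 2 := Nat.le_of_mul_le_mul_left hle hr.natDegree_pos
  have hn0 : n ≠ 0 := by
    rintro rfl
    exact h0 hn
  have hn2' : n ≠ 2 := by
    rintro rfl
    exact hne (hκr.exists_C hr0 (by rw [hφ.rank_two, hn, mul_comm]))
  obtain rfl : n = 1 := by omega
  exact ⟨by rw [hn, mul_one], hv rfl⟩

/-- `τ_L` acts as a power map, which has no nonzero root, whereas a separable `κ` of positive degree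
has one. -/
theorem not_rightDvd_tauL {κ : Ore Fq L} (hκ : κ.IsSeparable) (h0 : κ.tdeg ≠ 0) :
    ¬ κ.RightDvd (Ore.tauL Fq L) := by
  intro hd
  let K := AlgebraicClosure L
  have hker := Ore.natCard_ker K hκ
  have := Ore.finite_ker K hκ.ne_zero
  have h1 : 1 < Nat.card (κ.ker K) := by
    rw [hker]
    exact Nat.one_lt_pow h0 Fintype.one_lt_card
  have : Nontrivial (κ.ker K) := Finite.one_lt_card_iff_nontrivial.1 h1
  obtain ⟨x, hx⟩ := exists_ne (0 : κ.ker K)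
  have h2 := (Ore.mem_ker K).1 (hd.ker_le K x.2)
  have h3 := Ore.act_C_mul_tau_pow K (Fq := Fq) (1 : L) (Module.finrank Fq L) x
  rw [map_one, one_mul, map_one, one_mul] at h3
  rw [Ore.tauL, h3] at h2
  exact hx (Subtype.ext (pow_eq_zero_iff (pow_ne_zero _ Fintype.card_ne_zero) |>.1 h2))

/-- A proper separable subgroup of the `r`-torsion is cut out by `φ_r` and `τ_L - φ_v`. -/
theorem MemDr2.span_eq (hφ : φ.MemDr2 h f) (hodd : Odd (Module.finrank Fq L))
    (hs : IsSmoothAffine h f) {κ : Ore Fq L} (hκ : κ.IsSeparable) {r v : Fq[X]}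
    (hr : Irreducible r) (hκr : κ.RightDvd (φ.toHom r)) (h0 : κ.tdeg ≠ 0)
    (hd : κ.tdeg = r.natDegree) (hv : κ.RightDvd (Ore.tauL Fq L - φ.toHom v)) :
    (Ideal.span {φ.toHom r, Ore.tauL Fq L - φ.toHom v} : Ideal (Ore Fq L)) = Ideal.span {κ} := by
  have hr0 := hφ.rank_two.toHom_ne_zero hr.ne_zero
  obtain ⟨g, hg⟩ := Ore.exists_isRgcd (S := {φ.toHom r, Ore.tauL Fq L - φ.toHom v})
    ⟨_, Set.mem_insert _ _, hr0⟩
  obtain ⟨A, B, e⟩ := hg.exists_eq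
  have hgr : g.RightDvd (φ.toHom r) := hg.rightDvd (by simp)
  have hgv : g.RightDvd (Ore.tauL Fq L - φ.toHom v) := hg.rightDvd (by simp)
  have hκg : κ.RightDvd g := e ▸ (hκr.mul_left A).add (hv.mul_left B)
  -- Otherwise `r` and `v` both lie in the kernel of `γ`, so `r ∣ v`, and `κ` right-divides `τ_L`,
  -- which a nonconstant separable polynomial cannot do. This covers the case where `r` is the
  -- characteristic.
  have hsep : g.IsSeparable := by
    intro hg0
    have hγr : γ r = 0 := by
      obtain ⟨W, hW⟩ := hgr
      rw [← φ.coeff_zero, hW, Ore.coeff_mul_zero, hg0, mul_zero]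
    have hγv : γ v = 0 := by
      obtain ⟨W, hW⟩ := hgv
      have h1 := congrArg (fun P => P.coeff 0) hW
      have h2 := Ore.coeff_C_mul_tau_pow (Fq := Fq) (1 : L) (Module.finrank Fq L) 0
      rw [map_one, one_mul, if_neg hodd.pos.ne'] at h2
      simp only [Ore.coeff_sub, Ore.coeff_mul_zero, hg0, mul_zero, φ.coeff_zero] at h1
      rwa [Ore.tauL, h2, zero_sub, neg_eq_zero] at h1
    have hrv : r ∣ v := by
      by_contra hrv
      obtain ⟨x, y, hxy⟩ := hr.exists_mul_add_mul_eq_one hrv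
      have := congrArg γ hxy
      simp [hγr, hγv] at this
    refine not_rightDvd_tauL hκ h0 ?_
    have := hv.add (hκr.trans (φ.rightDvd_toHom_of_dvd hrv))
    rwa [sub_add_cancel] at this
  have hst : ∀ a, g.RightDvd (g * φ.toHom a) := by
    intro a
    have h1 := (hgr.mul_left (A * φ.toHom a)).add (hgv.mul_left (B * φ.toHom a))
    have h2 : φ.toHom a * (Ore.tauL Fq L - φ.toHom v) =
        (Ore.tauL Fq L - φ.toHom v) * φ.toHom a := by
      rw [mul_sub, sub_mul, (Ore.commute_tauL _).eq, φ.commute_toHom]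
    rwa [mul_assoc, φ.commute_toHom, mul_assoc B, h2, ← mul_assoc, ← mul_assoc, ← add_mul,
      ← e] at h1
  -- `g` lies between `κ` and `φ_r`, and it is not `φ_r` up to a constant because it right-divides
  -- `τ_L - φ_v`.
  have hgd : g.tdeg = r.natDegree := by
    refine (hφ.tdeg_eq_and_exists hsep hst hr hgr ?_ ?_).1
    · have := hκg.tdeg_le hg.ne_zero
      omega
    · rintro ⟨c, hc, hgc⟩
      refine hφ.not_rightDvd_tauL_sub hodd hs hr v (Ore.RightDvd.trans ⟨Ore.C c, hgc⟩ hgv)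
  obtain ⟨c, hc, rfl⟩ := hκg.exists_C hg.ne_zero (by omega)
  rw [hg.2, Ore.span_C_mul hc]

/-- The conjugate of `Y` is `-h - Y`, so the left-hand side is the norm of `Y - v`. -/
theorem of_eq_mul (v : Fq[X]) :
    AdjoinRoot.of (xi h f) (v ^ 2 + h * v - f) =
      (AdjoinRoot.root (xi h f) - AdjoinRoot.of (xi h f) v) *
        (-AdjoinRoot.of (xi h f) h - AdjoinRoot.root (xi h f) - AdjoinRoot.of (xi h f) v) := by
  rw [map_sub, ← root_sq, map_add, map_pow, map_mul]
  ring

theorem MemDr2.dvd_norm (hφ : φ.MemDr2 h f) {κ : Ore Fq L} {r v : Fq[X]}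
    (hr : Irreducible r) (hκr : κ.RightDvd (φ.toHom r)) (h0 : κ.tdeg ≠ 0)
    (hv : κ.RightDvd (Ore.tauL Fq L - φ.toHom v)) : r ∣ v ^ 2 + h * v - f := by
  refine φ.dvd_of_rightDvd_toHom hr h0 hκr ?_
  rw [← φ.evalA_of hφ, of_eq_mul, mul_comm, map_mul, map_sub (φ.evalA hφ) (AdjoinRoot.root _),
    evalA_root, evalA_of]
  exact hv.mul_left _

/-- Evaluation embeds the coordinate ring in the domain `L{τ}`: in `φ_a + φ_b τ_L` the two terms
have degrees of opposite parity and cannot cancel. -/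
theorem MemDr2.eq_of_mul_eq (hφ : φ.MemDr2 h f) (hodd : Odd (Module.finrank Fq L))
    {r : Fq[X]} (hr : r ≠ 0) {g g' : CoordRing h f}
    (he : AdjoinRoot.of (xi h f) r * g = AdjoinRoot.of (xi h f) r * g') : g = g' := by
  rw [← sub_eq_zero, ← mul_sub] at he
  rw [← sub_eq_zero]
  obtain ⟨a, b, hab⟩ := exists_eq_of_add_of_mul_root (g - g')
  have h1 := congrArg (φ.evalA hφ) he
  rw [map_mul, evalA_of, map_zero, mul_eq_zero,
    or_iff_right (hφ.rank_two.toHom_ne_zero hr), hab, map_add, map_mul, evalA_of, evalA_of,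
    evalA_root] at h1
  have hb : b = 0 := by
    by_contra hb
    have hb' := hφ.rank_two.toHom_ne_zero hb
    have hτ : Ore.tauL Fq L ≠ 0 := by
      simpa using hφ.tauL_ne_toHom hodd 0
    have h2 := congrArg Ore.tdeg (eq_neg_of_add_eq_zero_left h1)
    rw [← neg_mul, Ore.tdeg_mul (neg_ne_zero.2 hb') hτ, ← map_neg, hφ.rank_two, hφ.rank_two,
      Ore.tauL, Ore.tdeg_tau_pow] at h2
    obtain ⟨k, hk⟩ := hodd
    omega
  rw [hb, map_zero, zero_mul, add_zero] at h1
  have ha : a = 0 := by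
    by_contra ha
    exact hφ.rank_two.toHom_ne_zero ha h1
  rw [hab, ha, hb, map_zero, zero_mul, add_zero]

/-! ### The ideal associated to a composition -/

/-- `κ` intertwines the evaluations at `φ` and `φ'`: `A κ g(φ) = A g(φ') κ = A B η κ`. -/
theorem mul_assocIdeal_le (hφ : φ.MemDr2 h f) (hφ' : φ'.MemDr2 h f) {κ η : Ore Fq L}
    (hκ : φ.IsIsogeny φ' κ) (hη : φ'.IsIsogeny ψ η) (hηκ : φ.IsIsogeny ψ (η * κ))
    {J : Ideal (CoordRing h f)} (hJ : J ≤ φ.assocIdeal φ' hφ κ) :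
    J * φ'.assocIdeal ψ hφ' η ≤ φ.assocIdeal ψ hφ (η * κ) := by
  rw [Ideal.mul_le]
  intro p hp g hg
  obtain ⟨A, hA⟩ := (mem_assocIdeal hφ hκ).1 (hJ hp)
  obtain ⟨B, hB⟩ := (mem_assocIdeal hφ' hη).1 hg
  refine (mem_assocIdeal hφ hηκ).2 ⟨A * B, ?_⟩
  rw [map_mul, hA, mul_assoc, hκ.2.mul_evalA hφ hφ', hB]
  simp only [mul_assoc]

/-- Expand `η` in values `g(φ')`, move `κ` to the left by `g(φ') κ = κ g(φ)`, then expand `κ` in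
values `p(φ)`. -/
theorem mul_mem_span (hφ : φ.MemDr2 h f) (hφ' : φ'.MemDr2 h f) {κ η : Ore Fq L}
    (hκ : φ.IsIsogeny φ' κ) {I J : Ideal (CoordRing h f)}
    (hJ : κ ∈ Ideal.span (φ.evalA hφ '' (J : Set (CoordRing h f))))
    (hI : η ∈ Ideal.span (φ'.evalA hφ' '' (I : Set (CoordRing h f)))) :
    η * κ ∈ Ideal.span (φ.evalA hφ '' ((J * I : Ideal _) : Set (CoordRing h f))) := by
  have key : ∀ g ∈ I, ∀ y ∈ Ideal.span (φ.evalA hφ '' (J : Set (CoordRing h f))),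
      y * φ.evalA hφ g ∈
        Ideal.span (φ.evalA hφ '' ((J * I : Ideal _) : Set (CoordRing h f))) := by
    intro g hg y hy
    induction hy using Submodule.span_induction with
    | mem y hy =>
      obtain ⟨p, hp, rfl⟩ := hy
      rw [← map_mul]
      exact Ideal.subset_span ⟨_, Ideal.mul_mem_mul hp hg, rfl⟩
    | zero => rw [zero_mul]; exact zero_mem _
    | add x y _ _ hx hy => rw [add_mul]; exact add_mem hx hy
    | smul a x _ hx => rw [smul_eq_mul, mul_assoc]; exact Ideal.mul_mem_left _ _ hx
  induction hI using Submodule.span_induction with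
  | mem y hy =>
    obtain ⟨g, hg, rfl⟩ := hy
    rw [← hκ.2.mul_evalA hφ hφ']
    exact key g hg κ hJ
  | zero => rw [zero_mul]; exact zero_mem _
  | add x y _ _ hx hy => rw [add_mul]; exact add_mem hx hy
  | smul a x _ hx => rw [smul_eq_mul, mul_assoc]; exact Ideal.mul_mem_left _ _ hx

/-- The point is that `φ_r` right-divides `φ_a + φ_b τ_L` only if `r` divides `a` and `b`; this is
maximality at `r` again. -/
theorem MemDr2.assocIdeal_mul_toHom (hφ : φ.MemDr2 h f) (hodd : Odd (Module.finrank Fq L))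
    (hs : IsSmoothAffine h f) {η : Ore Fq L} {r : Fq[X]} (hr : Irreducible r)
    (hη : φ.IsIsogeny ψ η) (hηr : φ.IsIsogeny ψ (η * φ.toHom r)) :
    φ.assocIdeal ψ hφ (η * φ.toHom r) =
      Ideal.span {AdjoinRoot.of (xi h f) r} * φ.assocIdeal ψ hφ η := by
  have hκ := hφ.rank_two.isIsogeny_toHom hr.ne_zero
  refine le_antisymm (fun g hg => ?_) (mul_assocIdeal_le hφ hφ hκ hη hηr ?_)
  · obtain ⟨A, hA⟩ := (mem_assocIdeal hφ hηr).1 hg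
    obtain ⟨a, b, rfl⟩ := exists_eq_of_add_of_mul_root g
    have hd : (φ.toHom r).RightDvd (φ.toHom a + φ.toHom b * Ore.tauL Fq L) := by
      refine ⟨A * η, ?_⟩
      rw [mul_assoc, ← hA]
      simp
    have hb : r ∣ b := by
      by_contra hb
      obtain ⟨x, y, hxy⟩ := hr.exists_mul_add_mul_eq_one hb
      -- With `x b + y r = 1`, multiplying by `φ_x` and adding `φ_y τ_L φ_r` leaves `τ_L + φ_(xa)`.
      refine hφ.not_rightDvd_tauL_sub hodd hs hr (-(x * a)) ?_
      have h1 := (hd.mul_left (φ.toHom x)).add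
        ((Ore.RightDvd.mul_left ⟨1, (one_mul _).symm⟩ (Ore.tauL Fq L)).mul_left (φ.toHom y))
      convert h1 using 1
      rw [← (Ore.commute_tauL (φ.toHom r)).eq, mul_add, ← mul_assoc, ← mul_assoc, add_assoc,
        ← add_mul, ← map_mul, ← map_mul, ← map_mul, ← map_add, hxy, map_one, one_mul, map_neg,
        sub_neg_eq_add, add_comm]
    obtain ⟨b, rfl⟩ := hb
    have ha : r ∣ a := by
      refine hφ.rank_two.dvd_of_rightDvd hr.ne_zero ?_
      have h1 := hd.sub (Q := _) (R := φ.toHom (r * b) * Ore.tauL Fq L)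
        ⟨φ.toHom b * Ore.tauL Fq L, by
          rw [mul_assoc, ← (Ore.commute_tauL (φ.toHom r)).eq, ← mul_assoc, ← map_mul, mul_comm r]⟩
      rwa [add_sub_cancel_right] at h1
    obtain ⟨a, rfl⟩ := ha
    have e : AdjoinRoot.of (xi h f) (r * a) +
        AdjoinRoot.of (xi h f) (r * b) * AdjoinRoot.root (xi h f) =
        AdjoinRoot.of (xi h f) r * (AdjoinRoot.of (xi h f) a +
          AdjoinRoot.of (xi h f) b * AdjoinRoot.root (xi h f)) := by
      rw [map_mul, map_mul]
      ring
    rw [e] at hA ⊢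
    refine Ideal.mul_mem_mul (Ideal.mem_span_singleton_self _)
      ((mem_assocIdeal hφ hη).2 ⟨A, mul_right_cancel₀ hκ.1 ?_⟩)
    rw [mul_comm, map_mul, evalA_of] at hA
    rw [hA, mul_assoc]
  · rw [Ideal.span_le, Set.singleton_subset_iff, SetLike.mem_coe, mem_assocIdeal hφ hκ, evalA_of]
    exact ⟨1, (one_mul _).symm⟩

/-- Let `R = r`, `S = Y - v` and let `S'` be its conjugate, so that `S S' = R N`. For `g` in the
ideal of `η κ`, both `g` and `g₂ = S' g / R` lie in the ideal of `η`. Smoothness then allows `g` to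
be rebuilt from these two with coefficients in `(R, S)`. -/
theorem MemDr2.assocIdeal_mul (hφ : φ.MemDr2 h f) (hφ' : φ'.MemDr2 h f)
    (hodd : Odd (Module.finrank Fq L)) (hs : IsSmoothAffine h f) {κ η : Ore Fq L} {r v : Fq[X]}
    (hr : Irreducible r) (hκr : κ.RightDvd (φ.toHom r)) (h0 : κ.tdeg ≠ 0)
    (hv : κ.RightDvd (Ore.tauL Fq L - φ.toHom v))
    (hspan : (Ideal.span {φ.toHom r, Ore.tauL Fq L - φ.toHom v} : Ideal (Ore Fq L)) =
      Ideal.span {κ})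
    (hκ : φ.IsIsogeny φ' κ) (hη : φ'.IsIsogeny ψ η) (hηκ : φ.IsIsogeny ψ (η * κ)) :
    φ.assocIdeal ψ hφ (η * κ) =
      Ideal.span {AdjoinRoot.of (xi h f) r,
        AdjoinRoot.root (xi h f) - AdjoinRoot.of (xi h f) v} * φ'.assocIdeal ψ hφ' η := by
  refine le_antisymm (fun g hg => ?_) (mul_assocIdeal_le hφ hφ' hκ hη hηκ ?_)
  swap
  · rw [Ideal.span_le]
    rintro _ (rfl | rfl)
    · exact (mem_assocIdeal hφ hκ).2 (by simpa using hκr)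
    · exact (mem_assocIdeal hφ hκ).2 (by simpa using hv)
  set R := AdjoinRoot.of (xi h f) r with hR
  set S := AdjoinRoot.root (xi h f) - AdjoinRoot.of (xi h f) v with hS
  set S' := -AdjoinRoot.of (xi h f) h - AdjoinRoot.root (xi h f) - AdjoinRoot.of (xi h f) v with hS'
  have hRP : R ∈ Ideal.span {R, S} := Ideal.subset_span (by simp)
  have hSP : S ∈ Ideal.span {R, S} := Ideal.subset_span (by simp)
  obtain ⟨N, hN⟩ := hφ.dvd_norm hr hκr h0 hv
  have hSS' : S * S' = R * AdjoinRoot.of (xi h f) N := by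
    rw [hR, ← map_mul, ← hN, of_eq_mul]
  obtain ⟨A, hA⟩ := (mem_assocIdeal hφ hηκ).1 hg
  -- decompose `g` in the ideal of `κ`
  obtain ⟨s, t, hst⟩ : ∃ s t, g = R * s + S * t := by
    obtain ⟨a, b, hab⟩ := exists_eq_of_add_of_mul_root g
    have h1 : κ.RightDvd (φ.toHom (a + b * v)) := by
      have h2 : κ.RightDvd (φ.evalA hφ g) := ⟨A * η, by rw [hA, mul_assoc]⟩
      have h3 := h2.sub (hv.mul_left (φ.toHom b))
      convert h3 using 1
      rw [hab, map_add, map_mul, map_add, map_mul, evalA_of, evalA_of, evalA_root, mul_sub]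
      abel
    obtain ⟨k, hk⟩ := φ.dvd_of_rightDvd_toHom hr h0 hκr h1
    refine ⟨AdjoinRoot.of (xi h f) k, AdjoinRoot.of (xi h f) b, ?_⟩
    rw [hR, ← map_mul, ← hk, hab, hS, map_add, map_mul]
    ring
  have hg' : g ∈ φ'.assocIdeal ψ hφ' η := by
    refine (mem_assocIdeal hφ' hη).2 ⟨κ * A, mul_right_cancel₀ hκ.1 ?_⟩
    rw [← hκ.2.mul_evalA hφ hφ', hA]
    simp only [mul_assoc]
  -- The quotient `S' g / R`, computed from `g = R s + S t` and `S S' = R N`.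
  set g₂ := S' * s + AdjoinRoot.of (xi h f) N * t with hg₂
  have hgg₂ : S' * g = R * g₂ := by
    rw [hst, hg₂]
    linear_combination t * hSS'
  have hg₂' : g₂ ∈ φ'.assocIdeal ψ hφ' η := by
    -- Since `κ = B φ_r + D S(φ)`, multiplying by `S'(φ)` turns the second term into a multiple of
    -- `φ_r` too.
    obtain ⟨w, hw⟩ : (φ.toHom r).RightDvd (κ * φ.evalA hφ S') := by
      have hκs : κ ∈ (Ideal.span {φ.toHom r, Ore.tauL Fq L - φ.toHom v} : Ideal (Ore Fq L)) :=
        hspan ▸ Ideal.subset_span rfl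
      obtain ⟨B, D, e⟩ := Ore.mem_span_pair.1 hκs
      have e1 : Ore.tauL Fq L - φ.toHom v = φ.evalA hφ S := by simp [hS]
      rw [e, add_mul, ← φ.evalA_of hφ r, e1, mul_assoc, mul_assoc, ← map_mul, ← map_mul, hSS',
        mul_comm _ S', mul_comm _ (AdjoinRoot.of (xi h f) N), map_mul, map_mul]
      exact Ore.RightDvd.add ⟨B * φ.evalA hφ S', by rw [mul_assoc]⟩
        ⟨D * φ.evalA hφ (AdjoinRoot.of (xi h f) N), by rw [mul_assoc]⟩
    refine (mem_assocIdeal hφ' hη).2 ⟨w * A, mul_right_cancel₀ hκ.1 ?_⟩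
    refine mul_right_cancel₀ (hφ.rank_two.toHom_ne_zero hr.ne_zero) ?_
    rw [← hκ.2.mul_evalA hφ hφ', mul_assoc, ← φ.evalA_of hφ r, ← map_mul, mul_comm g₂, ← hgg₂,
      map_mul, ← mul_assoc, hw, evalA_of, mul_assoc, ← φ.evalA_mem_End hφ g r, hA]
    simp only [mul_assoc]
  -- If `r ∣ 2v + h`, smoothness makes `N` invertible modulo `r`, and `R N g = S S' g = R S g₂`
  -- recovers `g`. Otherwise `S + S' = -(2v + h)` is invertible modulo `r`, and `S' g = R g₂`
  -- recovers it.
  by_cases hc : r ∣ 2 * v + h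
  · have hrN : ¬ r ∣ N := by
      rintro ⟨k, rfl⟩
      exact hs.not_sq_dvd hr v hc ⟨k, by rw [hN]; ring⟩
    obtain ⟨a, b, hab⟩ := hr.exists_mul_add_mul_eq_one hrN
    have hab' := congrArg (AdjoinRoot.of (xi h f)) hab
    rw [map_add, map_mul, map_mul, map_one] at hab'
    have e : g = S * (AdjoinRoot.of (xi h f) a * g₂) + R * (AdjoinRoot.of (xi h f) b * g) := by
      refine hφ.eq_of_mul_eq hodd hr.ne_zero ?_
      linear_combination (-R * g) * hab' - (AdjoinRoot.of (xi h f) a * g) * hSS' +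
        (AdjoinRoot.of (xi h f) a * S) * hgg₂
    rw [e]
    exact add_mem (Ideal.mul_mem_mul hSP (Ideal.mul_mem_left _ _ hg₂'))
      (Ideal.mul_mem_mul hRP (Ideal.mul_mem_left _ _ hg'))
  · obtain ⟨a, b, hab⟩ := hr.exists_mul_add_mul_eq_one hc
    have hab' := congrArg (AdjoinRoot.of (xi h f)) hab
    simp only [map_add, map_mul, map_one, map_ofNat] at hab'
    have e : g = R * (AdjoinRoot.of (xi h f) b * g - AdjoinRoot.of (xi h f) a * g₂) +
        S * (-AdjoinRoot.of (xi h f) a * g) := by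
      linear_combination (-g) * hab' - AdjoinRoot.of (xi h f) a * hgg₂
    rw [e]
    exact add_mem (Ideal.mul_mem_mul hRP
        (sub_mem (Ideal.mul_mem_left _ _ hg') (Ideal.mul_mem_left _ _ hg₂')))
      (Ideal.mul_mem_mul hSP (Ideal.mul_mem_left _ _ hg'))

end DrinfeldModule

end

/-! ### Execution of the algorithm: progress, termination, correctness. -/

section

variable {Fq L : Type*} [Field Fq] [Fintype Fq] [Field L] [Algebra Fq L]
  [FiniteDimensional Fq L] {γ : Fq[X] →ₐ[Fq] L}

/-- Remainders are congruent to `τ_L` and `φ_(X^i)` modulo the left ideal of `κ`, so any solution of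
the system serves, unique or not. -/
theorem PrimeIsogenyToPrimeIdeal.rightDvd {φ : DrinfeldModule γ} {κ : Ore Fq L} {r v : Fq[X]}
    (hv : PrimeIsogenyToPrimeIdeal φ κ r v) : κ.RightDvd (Ore.tauL Fq L - φ.toHom v) := by
  obtain ⟨y, ρ, c, hy, hρ, h0, rfl⟩ := hv
  have e : Ore.tauL Fq L - φ.toHom (∑ i, C (c i) * X ^ (i : ℕ)) =
      (Ore.tauL Fq L - y) - ∑ i, c i • (φ.toHom (X ^ (i : ℕ)) - ρ i) := by
    rw [map_sum, sub_eq_zero.1 h0]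
    simp only [smul_sub, Finset.sum_sub_distrib, ← smul_eq_C_mul, map_smul]
    abel
  rw [e, ← Ore.mem_span_singleton]
  refine sub_mem (Ore.mem_span_singleton.2 hy.rightDvd_sub) (sum_mem fun i _ => ?_)
  rw [Algebra.smul_def]
  exact Ideal.mul_mem_left _ _ (Ore.mem_span_singleton.2 (hρ i).rightDvd_sub)

/-- Reduce the eigenvalue `v` modulo `r` so that it has coefficients only below `deg r`. The
corresponding combination of remainders is right-divisible by `κ` and has only coefficients below
its degree, so it is zero. -/
theorem exists_primeIsogenyToPrimeIdeal {φ : DrinfeldModule γ} {κ : Ore Fq L} {r v : Fq[X]}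
    (hr : 0 < r.natDegree) (hκ : κ ≠ 0) (hκr : κ.RightDvd (φ.toHom r))
    (hv : κ.RightDvd (Ore.tauL Fq L - φ.toHom v)) :
    ∃ w, PrimeIsogenyToPrimeIdeal φ κ r w := by
  obtain ⟨y, hy⟩ := Ore.exists_rightRem (Ore.tauL Fq L) hκ
  choose ρ hρ using fun i : Fin r.natDegree =>
    Ore.exists_rightRem (φ.toHom (X ^ (i : ℕ))) hκ
  set w := v % r with hw
  have hwd : w.natDegree < r.natDegree := natDegree_mod_lt _ hr.ne'
  have hvw : κ.RightDvd (Ore.tauL Fq L - φ.toHom w) := by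
    have := hv.add (hκr.trans (φ.rightDvd_toHom_of_dvd (dvd_mul_right r (v / r))))
    rwa [sub_add, ← map_sub, ← EuclideanDomain.mod_eq_sub_mul_div] at this
  have hsum : w = ∑ i : Fin r.natDegree, C (w.coeff i) * X ^ (i : ℕ) := by
    rw [Fin.sum_univ_eq_sum_range (fun i => C (w.coeff i) * X ^ i)]
    exact as_sum_range_C_mul_X_pow' w hwd
  refine ⟨w, y, ρ, fun i => w.coeff i, hy, hρ, ?_, hsum⟩
  have hd : κ.RightDvd (y - ∑ i : Fin r.natDegree, w.coeff i • ρ i) := by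
    have e : y - ∑ i : Fin r.natDegree, w.coeff i • ρ i =
        (Ore.tauL Fq L - φ.toHom w) - (Ore.tauL Fq L - y) +
          ∑ i : Fin r.natDegree, w.coeff i • (φ.toHom (X ^ (i : ℕ)) - ρ i) := by
      conv_rhs => rw [hsum, map_sum]
      simp only [smul_sub, Finset.sum_sub_distrib, ← smul_eq_C_mul, map_smul]
      simp only [smul_eq_C_mul, ← hsum]
      abel
    rw [e, ← Ore.mem_span_singleton]
    refine add_mem (sub_mem (Ore.mem_span_singleton.2 hvw)
      (Ore.mem_span_singleton.2 hy.rightDvd_sub)) (sum_mem fun i _ => ?_)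
    rw [Algebra.smul_def]
    exact Ideal.mul_mem_left _ _ (Ore.mem_span_singleton.2 (hρ i).rightDvd_sub)
  by_contra h0
  have h1 := hd.tdeg_le h0
  refine absurd h1 (not_le.2 (Ore.tdeg_lt h0 fun k hk => ?_))
  have hrem : ∀ {P R : Ore Fq L}, Ore.IsRightRem P κ R → R.coeff k = 0 := by
    rintro P R ⟨-, rfl | hR⟩
    · rfl
    · exact Ore.coeff_eq_zero_of_tdeg_lt (by omega)
  rw [Ore.coeff_sub, hrem hy, Ore.coeff_sum, zero_sub, neg_eq_zero]
  refine Finset.sum_eq_zero fun i _ => ?_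
  rw [Algebra.smul_def]
  change (Ore.C (algebraMap Fq L (w.coeff i)) * ρ i).coeff k = 0
  have := Ore.coeff_mul (Ore.C (algebraMap Fq L (w.coeff i)) : Ore Fq L) (ρ i) k
  rw [this, Finset.sum_eq_single 0]
  · simp [hrem (hρ i)]
  · intro j _ hj
    rw [Ore.coeff_C, if_neg (Ne.symm hj), zero_mul]
  · simp

open DrinfeldModule

variable {h f : Fq[X]}

/-- The arguments `s` are those of an admissible call for an isogeny with codomain `ψ`. -/
structure Args.IsAdmissible (h f : Fq[X]) (ψ : DrinfeldModule γ) (s : Args γ) : Prop where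
  memDr2 : s.φ.MemDr2 h f
  isIsogeny : s.φ.IsIsogeny ψ s.ι
  isSeparable : s.ι.IsSeparable
  monic : s.u.Monic
  rightDvd : s.ι.RightDvd (s.φ.toHom s.u)

/-- `𝔞` is the ideal associated to the isogeny in `s`, and this isogeny is in the left ideal
generated by `𝔞`. -/
def Args.IsResult (h f : Fq[X]) (ψ : DrinfeldModule γ) (s : Args γ)
    (𝔞 : Ideal (CoordRing h f)) : Prop :=
  ∃ hφ : s.φ.MemDr2 h f, 𝔞 = s.φ.assocIdeal ψ hφ s.ι ∧
    s.ι ∈ Ideal.span (s.φ.evalA hφ '' (𝔞 : Set (CoordRing h f)))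

theorem IsPrimeFactor.natDegree_div_lt {r u : Fq[X]} (hr : IsPrimeFactor r u) (hu : u.Monic) :
    (u / r).Monic ∧ r * (u / r) = u ∧ (u / r).natDegree < u.natDegree := by
  have he : r * (u / r) = u := EuclideanDomain.mul_div_cancel' hr.1.ne_zero hr.2.2
  have hm : (u / r).Monic := hr.1.of_mul_monic_left (he.symm ▸ hu)
  refine ⟨hm, he, ?_⟩
  have := congrArg natDegree he
  rw [hr.1.natDegree_mul hm] at this
  have := hr.2.1.natDegree_pos
  omega

theorem IsPrimeFactor.natDegree_div_pow_lt {r u : Fq[X]} (hr : IsPrimeFactor r u)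
    (hu : u.Monic) :
    (u / r ^ multiplicity r u).Monic ∧
      r ^ multiplicity r u * (u / r ^ multiplicity r u) = u ∧
      (u / r ^ multiplicity r u).natDegree < u.natDegree := by
  have hrm : (r ^ multiplicity r u).Monic := hr.1.pow _
  have he := EuclideanDomain.mul_div_cancel' hrm.ne_zero (pow_multiplicity_dvd r u)
  have hm : (u / r ^ multiplicity r u).Monic := hrm.of_mul_monic_left (he.symm ▸ hu)
  refine ⟨hm, he, ?_⟩
  have := congrArg natDegree he
  rw [hrm.natDegree_mul hm, natDegree_pow] at this
  have := Nat.mul_pos (multiplicity_pos_of_dvd hr.2.2) hr.2.1.natDegree_pos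
  omega

theorem Args.IsAdmissible.properties_of_proper {ψ φ : DrinfeldModule γ} {ι : Ore Fq L}
    {u r : Fq[X]} (ha : Args.IsAdmissible h f ψ ⟨φ, ι, u⟩) (hr : Irreducible r) {κ : Ore Fq L}
    (hgcd : Ore.IsRgcd {ι, φ.toHom r} κ) (hne : κ ≠ 1)
    (hproper : ¬ ∃ c : L, c ≠ 0 ∧ κ = Ore.C c * φ.toHom r) :
    κ.IsSeparable ∧ κ.RightDvd ι ∧ κ.RightDvd (φ.toHom r) ∧ κ.tdeg ≠ 0 ∧
      κ.tdeg = r.natDegree ∧ (∃ v, κ.RightDvd (Ore.tauL Fq L - φ.toHom v)) ∧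
      ∃ φt, φ.IsIsogeny φt κ := by
  have hκι : κ.RightDvd ι := hgcd.rightDvd (by simp)
  have hκr : κ.RightDvd (φ.toHom r) := hgcd.rightDvd (by simp)
  have hsep := hκι.isSeparable ha.isSeparable
  have hst := rightDvd_mul_toHom_of_isRgcd hgcd ha.isIsogeny
  have h0 : κ.tdeg ≠ 0 := fun h0 => hne (hgcd.eq_one_of_tdeg_eq_zero h0)
  obtain ⟨hd, hv⟩ := ha.memDr2.tdeg_eq_and_exists hsep hst hr hκr h0 hproper
  exact ⟨hsep, hκι, hκr, h0, hd, hv, φ.exists_isIsogeny hsep hst⟩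

theorem Args.IsAdmissible.exists_callStep {ψ : DrinfeldModule γ} {s : Args γ}
    (ha : s.IsAdmissible h f ψ) (hu : s.u ≠ 1) {r : Fq[X]} (hr : IsPrimeFactor r s.u) :
    ∃ J s', CallStep h f s r J s' := by
  obtain ⟨φ, ι, u⟩ := s
  obtain ⟨κ, hκ⟩ := Ore.exists_isRgcd (S := {ι, φ.toHom r})
    ⟨_, Set.mem_insert _ _, ha.isIsogeny.1⟩
  by_cases h1 : κ = 1
  · exact ⟨_, _, CallStep.coprime φ ι u r hu hr (h1 ▸ hκ)⟩
  by_cases h2 : ∃ c : L, c ≠ 0 ∧ κ = Ore.C c * φ.toHom r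
  · obtain ⟨W, hW⟩ : κ.RightDvd ι := hκ.rightDvd (by simp)
    obtain ⟨c, hc, e⟩ := h2
    exact ⟨_, _, CallStep.full φ ι u r hu hr κ hκ h1 ⟨c, hc, e⟩ (W * Ore.C c)
      (by rw [hW, e, mul_assoc])⟩
  · obtain ⟨hsep, ⟨W, hW⟩, hκr, -, -, ⟨v, hv⟩, φt, hφt⟩ :=
      ha.properties_of_proper hr.2.1 hκ h1 h2
    obtain ⟨w, hw⟩ := exists_primeIsogenyToPrimeIdeal hr.2.1.natDegree_pos hκ.ne_zero hκr hv
    exact ⟨_, _, CallStep.proper φ ι u r hu hr κ hκ h1 h2 w hw φt (hφt.isVeluCodomain hsep) W hW⟩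

/-- The codomain `ψ` stays fixed through the recursion; only the domain and the quotient isogeny
change. -/
theorem CallStep.spec (hodd : Odd (Module.finrank Fq L)) (hs : IsSmoothAffine h f)
    {ψ : DrinfeldModule γ} {s s' : Args γ} {r : Fq[X]} {J : Ideal (CoordRing h f)}
    (hc : CallStep h f s r J s') (ha : s.IsAdmissible h f ψ) :
    s'.IsAdmissible h f ψ ∧ s'.u.natDegree < s.u.natDegree ∧
      ∀ I, s'.IsResult h f ψ I → s.IsResult h f ψ (J * I) := by
  cases hc with
  | coprime φ ι u r hu hr hgcd =>
    obtain ⟨hm, he, hlt⟩ := hr.natDegree_div_pow_lt ha.monic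
    refine ⟨⟨ha.memDr2, ha.isIsogeny, ha.isSeparable, hm, ?_⟩, hlt, fun I hI => ?_⟩
    · exact rightDvd_toHom_of_pow_mul hgcd ha.isIsogeny _ (he.symm ▸ ha.rightDvd)
    · rw [← Ideal.one_eq_top, one_mul]
      exact hI
  | full φ ι u r hu hr κ hgcd hne hfull η hη =>
    have hφ := ha.memDr2
    have hι := ha.isIsogeny
    have hsep := ha.isSeparable
    have hdvd := ha.rightDvd
    dsimp only at hφ hι hsep hdvd
    subst hη
    obtain ⟨hm, he, hlt⟩ := hr.natDegree_div_lt ha.monic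
    have hκ := hφ.rank_two.isIsogeny_toHom hr.1.ne_zero
    have hη := hκ.of_mul hι
    refine ⟨⟨hφ, hη, ?_, hm, ?_⟩, hlt, fun I hI => ?_⟩
    · intro h0
      exact hsep (by rw [Ore.coeff_mul_zero, h0, zero_mul])
    · obtain ⟨W, hW⟩ := hdvd
      refine ⟨W, mul_right_cancel₀ hκ.1 ?_⟩
      rw [mul_assoc, ← hW, ← map_mul, mul_comm, he]
    · obtain ⟨_, rfl, hspan⟩ := hI
      refine ⟨hφ, (hφ.assocIdeal_mul_toHom hodd hs hr.2.1 hη hι).symm, ?_⟩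
      refine mul_mem_span hφ hφ hκ (Ideal.subset_span ⟨_, Ideal.mem_span_singleton_self _, ?_⟩)
        hspan
      rw [evalA_of]
  | proper φ ι u r hu hr κ hgcd hne hproper v hv φt hφt η hη =>
    have hφ := ha.memDr2
    have hι := ha.isIsogeny
    have hsep := ha.isSeparable
    have hdvd := ha.rightDvd
    dsimp only at hφ hι hsep hdvd
    obtain ⟨hκsep, -, hκr, h0, hd, -, φ', hφ'⟩ :=
      ha.properties_of_proper hr.2.1 hgcd hne hproper
    -- The recursion has a unique solution, so the computed module is the codomain of `κ`.
    obtain rfl := (hφ'.isVeluCodomain hκsep).unique hφt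
    obtain ⟨hm, he, hlt⟩ := hr.natDegree_div_lt ha.monic
    have hu' := rightDvd_mul_toHom_of_mul (w := u / r) hgcd hι (he.symm ▸ hdvd)
    subst hη
    have hηi := hφ'.of_mul hι
    have hφ'm := hφ'.memDr2 hφ
    refine ⟨⟨hφ'm, hηi, ?_, hm, ?_⟩, hlt, fun I hI => ?_⟩
    · intro h0
      exact hsep (by rw [Ore.coeff_mul_zero, h0, zero_mul])
    · obtain ⟨W, hW⟩ := hu'
      refine ⟨W, mul_right_cancel₀ hφ'.1 ?_⟩
      rw [← hφ'.2, hW, mul_assoc]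
    · obtain ⟨_, rfl, hspan⟩ := hI
      have hvd := hv.rightDvd
      have hsp := hφ.span_eq hodd hs hκsep hr.2.1 hκr h0 hd hvd
      refine ⟨hφ, (hφ.assocIdeal_mul hφ'm hodd hs hr.2.1 hκr h0 hvd hsp hφ' hηi hι).symm, ?_⟩
      refine mul_mem_span hφ hφ'm hφ' ?_ hspan
      have hκs : κ ∈ (Ideal.span {φ.toHom r, Ore.tauL Fq L - φ.toHom v} : Ideal (Ore Fq L)) :=
        hsp ▸ Ideal.subset_span rfl
      refine Ideal.span_mono ?_ hκs
      rintro _ (rfl | rfl)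
      · exact ⟨_, Ideal.subset_span (Set.mem_insert _ _), φ.evalA_of hφ r⟩
      · exact ⟨_, Ideal.subset_span (Set.mem_insert_of_mem _ rfl), by simp⟩

theorem Args.IsAdmissible.terminates (hodd : Odd (Module.finrank Fq L))
    (hs : IsSmoothAffine h f) {ψ : DrinfeldModule γ} {s : Args γ}
    (ha : s.IsAdmissible h f ψ) : Terminates h f s := by
  generalize hn : s.u.natDegree = n
  induction n using Nat.strong_induction_on generalizing s with
  | _ n ih =>
    refine ⟨s, fun hu => ⟨?_, fun r hr => ha.exists_callStep hu hr⟩, fun r J s' hc => ?_⟩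
    · have hnu : ¬ IsUnit s.u := fun h1 => hu (ha.monic.eq_one_of_isUnit h1)
      obtain ⟨r, hr, hi, hd⟩ := exists_monic_irreducible_factor s.u hnu
      exact ⟨r, hr, hi, hd⟩
    · obtain ⟨ha', hlt, -⟩ := hc.spec hodd hs ha
      exact ih _ (hn ▸ hlt) ha' rfl

/-- Termination and progress together produce an output, so correctness is not vacuous. -/
theorem Terminates.exists_returns {s : Args γ} (ht : Terminates h f s) :
    ∃ 𝔞, Returns h f s 𝔞 := by
  induction ht with
  | intro s progress _ ih =>
    by_cases hu : s.u = 1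
    · obtain ⟨φ, ι, u⟩ := s
      obtain rfl : u = 1 := hu
      exact ⟨⊤, Returns.base φ ι⟩
    · obtain ⟨⟨r, hr⟩, hstep⟩ := progress hu
      obtain ⟨J, s', hc⟩ := hstep r hr
      obtain ⟨I, hI⟩ := ih r J s' hc
      exact ⟨J * I, Returns.recur s r J s' I hc hI⟩

theorem Returns.isResult (hodd : Odd (Module.finrank Fq L)) (hs : IsSmoothAffine h f)
    {ψ : DrinfeldModule γ} {s : Args γ} {𝔞 : Ideal (CoordRing h f)} (hR : Returns h f s 𝔞)
    (ha : s.IsAdmissible h f ψ) : s.IsResult h f ψ 𝔞 := by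
  induction hR with
  | base φ ι =>
    have hφ := ha.memDr2
    have hι := ha.isIsogeny
    obtain ⟨W, hW⟩ := ha.rightDvd
    dsimp only at hφ hι hW
    rw [map_one] at hW
    refine ⟨hφ, ?_, ?_⟩
    -- For `u = 1` the isogeny right-divides 1, so its ideal contains 1.
    · rw [eq_comm, Ideal.eq_top_iff_one, mem_assocIdeal hφ hι, map_one]
      exact ⟨W, hW⟩
    · have h1 : (1 : Ore Fq L) ∈ Ideal.span (φ.evalA hφ '' ((⊤ : Ideal (CoordRing h f)) :
          Set (CoordRing h f))) := Ideal.subset_span ⟨1, trivial, map_one _⟩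
      rw [← mul_one ι]
      exact Ideal.mul_mem_left _ _ h1
  | recur s r J s' I hc _ ih =>
    obtain ⟨ha', -, hI⟩ := hc.spec hodd hs ha
    exact hI I (ih ha')

theorem DrinfeldModule.exists_isStar {φ ψ : DrinfeldModule γ} (hφ : φ.MemDr2 h f)
    {ι : Ore Fq L} (hι : φ.IsIsogeny ψ ι) (hsep : ι.IsSeparable)
    (hspan : ι ∈ Ideal.span (φ.evalA hφ '' (φ.assocIdeal ψ hφ ι : Set (CoordRing h f)))) :
    ∃ (c : L) (φ' : DrinfeldModule γ), c ≠ 0 ∧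
      φ.IsStar hφ (φ.assocIdeal ψ hφ ι) (Ore.C c * ι) φ' ∧ ψ.IsIsogeny φ' (Ore.C c) := by
  set c := (ι.coeff ι.tdeg)⁻¹ with hc
  have hc0 : c ≠ 0 := inv_ne_zero (Ore.coeff_tdeg_ne_zero hι.1)
  have hsep' : (Ore.C c * ι).IsSeparable := by
    rw [Ore.IsSeparable, Ore.coeff_mul_zero, Ore.coeff_C_zero]
    exact mul_ne_zero hc0 hsep
  -- The codomain of `c ι` is the conjugate `c ψ c⁻¹`.
  obtain ⟨φ', hφ'⟩ := φ.exists_isIsogeny hsep' (fun a =>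
    ⟨Ore.C c * ψ.toHom a * Ore.C c⁻¹, by
      rw [mul_assoc _ _ (Ore.C c * ι), ← mul_assoc (Ore.C c⁻¹), Ore.C_inv_mul_C hc0, one_mul,
        mul_assoc, hι.2, mul_assoc]⟩)
  refine ⟨c, φ', hc0, ⟨⟨Ore.isMonic_C_inv_mul hι.1, ?_⟩, hφ'⟩, hι.of_mul hφ'⟩
  rw [Ore.span_C_mul hc0]
  refine le_antisymm ?_ ?_
  · rw [Ideal.span_le]
    rintro _ ⟨g, hg, rfl⟩
    exact Ore.mem_span_singleton.2 ((mem_assocIdeal hφ hι).1 hg)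
  · rwa [Ideal.span_le, Set.singleton_subset_iff]

end

end

theorem mainTheorem4 {Fq L : Type*} [Field Fq] [Fintype Fq] [Field L] [Algebra Fq L]
    [FiniteDimensional Fq L]
    (d m : ℕ) (hd : 5 ≤ d) (hd_odd : Odd d) (hm : m ∣ d)
    (p : Fq[X]) (hp_monic : p.Monic) (hp_irr : Irreducible p) (hp_deg : p.natDegree = d / m)
    (α : Fq) (hα : α ≠ 0)
    (h f : Fq[X]) (hf : f = C α * p ^ m)
    (hh_ne : h ≠ 0) (hh_deg : h.natDegree ≤ (d - 1) / 2) (hh_p : ¬ p ∣ h)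
    (hsmooth : IsSmoothAffine h f)
    (hL : Module.finrank Fq L = d)
    (γ : Fq[X] →ₐ[Fq] L) (hγ : γ p = 0)
    (φ ψ : DrinfeldModule γ) (hφ : φ.MemDr2 h f) (hψ : ψ.MemDr2 h f)
    (hφ_ord : φ.IsOrdinary) (hψ_ord : ψ.IsOrdinary)
    (ι : Ore Fq L) (hι : φ.IsIsogeny ψ ι) (hι_sep : ι.IsSeparable)
    (u : Fq[X]) (hu : u.Monic) (hιu : ι.RightDvd (φ.toHom u)) :
    Terminates h f ⟨φ, ι, u⟩ ∧
    (∀ 𝔞 : Ideal (CoordRing h f),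
      Returns h f ⟨φ, ι, u⟩ 𝔞 ↔ 𝔞 = φ.assocIdeal ψ hφ ι) ∧
    (∀ 𝔞 : Ideal (CoordRing h f), Returns h f ⟨φ, ι, u⟩ 𝔞 →
      ∃ (c : L) (φ' : DrinfeldModule γ), c ≠ 0 ∧
        φ.IsStar hφ 𝔞 (Ore.C c * ι) φ' ∧ ψ.IsIsogeny φ' (Ore.C c)) := by
  have hodd : Odd (Module.finrank Fq L) := hL.symm ▸ hd_odd
  have ha : Args.IsAdmissible h f ψ ⟨φ, ι, u⟩ := ⟨hφ, hι, hι_sep, hu, hιu⟩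
  have ht := ha.terminates hodd hsmooth
  have hres : ∀ 𝔞, Returns h f ⟨φ, ι, u⟩ 𝔞 → 𝔞 = φ.assocIdeal ψ hφ ι ∧
      ι ∈ Ideal.span (φ.evalA hφ '' (𝔞 : Set (CoordRing h f))) := fun 𝔞 hR => by
    obtain ⟨_, h1, h2⟩ := hR.isResult hodd hsmooth ha
    exact ⟨h1, h2⟩
  refine ⟨ht, fun 𝔞 => ⟨fun hR => (hres 𝔞 hR).1, ?_⟩, fun 𝔞 hR => ?_⟩
  -- Some output exists by termination, and it must be the associated ideal.
  · rintro rfl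
    obtain ⟨𝔟, hR⟩ := ht.exists_returns
    exact (hres 𝔟 hR).1 ▸ hR
  · obtain ⟨rfl, hspan⟩ := hres 𝔞 hR
    exact DrinfeldModule.exists_isStar hφ hι hι_sep hspan
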